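/- **Setting.** Fix an integer $d\ge 1$. A *Schmidt vector* is $\lambda\in\mathbb R_{\ge 0}^d$ with $\sum_i\lambda_i=1$; it stands for the state $\sum_j\sqrt{\lambda_j}\,|jj\rangle$, whose matrix is $\mathrm{diag}(\lambda)^{1/2}$. For a vector $x$, $x^\downarrow$ is its decreasing rearrangement, continued by zeros. Let $S_k$ be the $k$-th elementary symmetric polynomial; then $C_k(\lambda)=\big[S_k(\lambda)/S_k(\tfrac1d,\dots,\tfrac1d)\big]^{1/k}$ and $C_d$ is the *$G$-concurrence*. **Rules.** Let $V_{\mu\nu}=d^{-1/2}e^{-2\pi i\mu\nu/d}$ for $1\le\mu,\nu\le d$. The swapping function is $\mathcal S(x,y)=d\,\sigma^2\big(\mathrm{diag}(x^\downarrow)^{1/2}\,V\,\mathrm{diag}(y^\downarrow)^{1/2}\big)$ (squared singular values in decreasing order). The purification function maps a nonnegative vector $x$ of any finite dimension to $\mathcal P(x)=(\chi_1,\dots,\chi_d)$, where $s_1=\sum_i x_i$, $\chi_l=\max\{x^\downarrow_l,\ s_l/(d+1-l)\}$ and $s_{l+1}=s_l-\chi_l$. The parallel rule sends Schmidt vectors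 $\lambda_1,\dots,\lambda_m$ to $\mathcal P(\lambda_1\otimes\cdots\otimes\lambda_m)$ (Kronecker product, dimension $d^m$). The series rule combines vectors by $\mathcal S$, grouped from the left. **Network.** A parallel-then-series network between A and B consists of $N\ge1$ groups in series, the $i$-th group being $m_i\ge 1$ parallel links with Schmidt vectors $\lambda_{i,1},\dots,\lambda_{i,m_i}$. The *DET outcome* is $$\lambda_{\mathrm{DET}}=\mathcal S\big(\cdots\mathcal S(\mathcal S(\pi_1,\pi_2),\pi_3)\cdots,\pi_N\big),\qquad \pi_i=\mathcal P(\lambda_{i,1}\otimes\cdots\otimes\lambda_{i,m_i}).$$ **Generic protocols.** Initially the $i$-th group is one bipartite link with the full $d^{m_i}\times d^{m_i}$ matrix $\mathrm{diag}(\lambda_{i,1}\otimes\cdots\otimes\lambda_{i,m_i})^{1/2}$. A generic protocol consists of finitely many steps, each chosen depending on all earlier outcomes. A step is one of the following (link matrices are unnormalized and may be rectangular): - *swapping* of two consecutive links $\Psi,\Phi$: outcome $\alpha$ replaces them by the one link $\Psi X^\alpha\Phi$, where the finite family $\{X^\alpha\}$ is arbitrary subject to $\sum_\alpha \overline{X^\alpha_{\mu\nu}}X^\alpha_{\mu'\nu'}=\delta_{\mu\mu'}\delta_{\nu\nu'}$;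 - a *local measurement* at one end of a link $\Psi$: outcome $\alpha$ replaces it by $M^\alpha\Psi$ (left end) or $\Psi (M^\alpha)^{T}$ (right end), where the finite family $\{M^\alpha\}$, with any output dimension, is arbitrary subject to $\sum_\alpha M^{\alpha\dagger}M^\alpha=1$. Sequences of these at both ends are the purification protocols of that link. The protocol ends, for every sequence of outcomes, with a single $d\times d$ link $\Psi^\alpha$ between A and B. Its probability is $p_\alpha=\|\Psi^\alpha\|_2^2$, its Schmidt vector is $\lambda_\alpha=\sigma^2(\Psi^\alpha/\|\Psi^\alpha\|_2)$ when $p_\alpha\neq0$, and the *average $G$-concurrence* is $\sum_\alpha p_\alpha C_d(\lambda_\alpha)$, outcomes of probability $0$ contributing $0$. **Theorem (parallel-then-series optimality).** 1. For every parallel-then-series network, some generic protocol yields $\lambda_{\mathrm{DET}}$ deterministically (every outcome of nonzero probability has Schmidt vector $\lambda_{\mathrm{DET}}$), and $C_d(\lambda_{\mathrm{DET}})$ is the maximum of the average $G$-concurrence over all generic protocols. 2. Consider $\lambda_a,\lambda_b$ in parallel, followed in series by $\lambda_c,\lambda_e$ in parallel. A nested purification protocol performs two independent swapping protocols, one on $\lambda_a,\lambda_c$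 with a family $\{X^\alpha\}$ and one on $\lambda_b,\lambda_e$ with a family $\{Y^\beta\}$, and then, depending on $(\alpha,\beta)$, an arbitrary purification protocol with $d\times d$ outcomes on the tensor product of the two resulting links. Its average $G$-concurrence is at most $C_d\big(\mathcal S(\mathcal P(\lambda_a\otimes\lambda_b),\mathcal P(\lambda_c\otimes\lambda_e))\big)$. 3. Nested purification does not optimize the average $G$-concurrence in general: for every $d\ge2$ there are Schmidt vectors $\lambda_a,\lambda_b,\lambda_c,\lambda_e$ with strictly positive entries and a number $g<C_d\big(\mathcal S(\mathcal P(\lambda_a\otimes\lambda_b),\mathcal P(\lambda_c\otimes\lambda_e))\big)$ such that every nested purification protocol has average $G$-concurrence at most $g$. -/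

import Mathlib

open scoped Matrix Kronecker

noncomputable section

namespace DET

/-! ### Vectors of Schmidt numbers and concurrence monotones -/

/-- A vector of Schmidt numbers: nonnegative entries with sum one. -/
def IsSchmidt {d : ℕ} (lam : Fin d → ℝ) : Prop :=
  (∀ i, 0 ≤ lam i) ∧ ∑ i, lam i = 1

/-- The decreasing rearrangement of a vector, indexed from `0` and continued by zeros. -/
def desc {ι : Type} [Fintype ι] (x : ι → ℝ) (j : ℕ) : ℝ :=
  ((Finset.univ.val.map x).sort (· ≥ ·)).getD j 0

/-- The `k`-th elementary symmetric polynomial of the entries. -/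
def elemSymm {d : ℕ} (k : ℕ) (x : Fin d → ℝ) : ℝ :=
  ∑ s ∈ Finset.powersetCard k Finset.univ, ∏ i ∈ s, x i

/-- The `k`-concurrence `C_k`. -/
def concurrence {d : ℕ} (k : ℕ) (lam : Fin d → ℝ) : ℝ :=
  (elemSymm k lam / elemSymm k (fun _ : Fin d => 1 / (d : ℝ))) ^ (1 / (k : ℝ))

/-- The `G`-concurrence `C_d`. -/
def gConcurrence {d : ℕ} (lam : Fin d → ℝ) : ℝ :=
  concurrence d lam

/-! ### Matrices of bipartite states -/

/-- The squared singular values of a `d × d` matrix, in decreasing order. -/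
def sqSingular {d : ℕ} (A : Matrix (Fin d) (Fin d) ℂ) (i : Fin d) : ℝ :=
  ((Matrix.toEuclideanLin A).singularValues i) ^ 2

/-- The diagonal matrix `diag(x)^{1/2}`: the matrix of the state `∑ √(x j) |j j⟩`. -/
def sqrtDiag {ι : Type} [DecidableEq ι] (x : ι → ℝ) : Matrix ι ι ℂ :=
  Matrix.diagonal fun i => ((Real.sqrt (x i) : ℝ) : ℂ)

/-- The probability of an unnormalized outcome: its squared Hilbert-Schmidt norm. -/
def prob {d : ℕ} (A : Matrix (Fin d) (Fin d) ℂ) : ℝ :=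
  ∑ i, ∑ j, ‖A i j‖ ^ 2

/-- The Schmidt numbers of the normalized state of an unnormalized outcome
(meaningful when `prob A ≠ 0`). -/
def schmidt {d : ℕ} (A : Matrix (Fin d) (Fin d) ℂ) : Fin d → ℝ :=
  sqSingular ((((Real.sqrt (prob A))⁻¹ : ℝ) : ℂ) • A)

/-- The average `G`-concurrence of an ensemble of unnormalized outcomes. -/
def averageG {d : ℕ} (E : List (Matrix (Fin d) (Fin d) ℂ)) : ℝ :=
  (E.map fun A => prob A * gConcurrence (schmidt A)).sum

/-! ### Series and parallel rules -/

/-- The constant unitary `V`, with indices `μ, ν = 1, …, d`. -/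
def fourier (d : ℕ) : Matrix (Fin d) (Fin d) ℂ := fun μ ν =>
  ((Real.sqrt d : ℝ) : ℂ)⁻¹ *
    Complex.exp (-2 * (Real.pi : ℂ) * Complex.I * ((μ : ℂ) + 1) * ((ν : ℂ) + 1) / (d : ℂ))

/-- The swapping function `S(x, y) = d σ²(diag(x↓)^{1/2} V diag(y↓)^{1/2})`. -/
def swapFun {d : ℕ} (x y : Fin d → ℝ) (i : Fin d) : ℝ :=
  (d : ℝ) * sqSingular
    (sqrtDiag (fun j : Fin d => desc x j) * fourier d * sqrtDiag (fun j : Fin d => desc y j)) i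

/-- The value of the variable `s` in the recursion for the purification function after `l` steps:
the total minus the first `l` entries already produced. -/
def remainder {ι : Type} [Fintype ι] (d : ℕ) (x : ι → ℝ) : ℕ → ℝ
  | 0 => ∑ i, x i
  | l + 1 => remainder d x l - max (desc x l) (remainder d x l / ((d : ℝ) - (l : ℝ)))

/-- The purification function `P`, with values in dimension `d`: the `l`-th entry
(counted from `0`) is `max (x↓_l) (s / (d - l))`. -/
def purifyFun {ι : Type} [Fintype ι] (d : ℕ) (x : ι → ℝ) (l : Fin d) : ℝ :=
  max (desc x l) (remainder d x l / ((d : ℝ) - (l : ℝ)))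

/-- The Kronecker product `x₁ ⊗ ⋯ ⊗ x_m`, of dimension `d ^ m`. -/
def kron {m d : ℕ} (x : Fin m → Fin d → ℝ) (k : Fin m → Fin d) : ℝ :=
  ∏ j, x j (k j)

/-- The parallel rule. -/
def parallelRule {m d : ℕ} (x : Fin m → Fin d → ℝ) : Fin d → ℝ :=
  purifyFun d (kron x)

/-- The series rule, grouped from the left, for `n + 1` links. -/
def seriesRule {n d : ℕ} (x : Fin (n + 1) → Fin d → ℝ) : Fin d → ℝ :=
  (List.ofFn fun i : Fin n => x i.succ).foldl swapFun (x 0)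

/-- The Schmidt numbers that the series and parallel rules yield between the two ends of `n + 1`
parallel groups in series, where the group `i` has `m i` links. -/
def parallelThenSeries {n d : ℕ} (m : Fin (n + 1) → ℕ)
    (lam : (i : Fin (n + 1)) → Fin (m i) → Fin d → ℝ) : Fin d → ℝ :=
  seriesRule fun i => parallelRule (lam i)

/-! ### Generic probabilistic protocols -/

/-- A bipartite (unnormalized) pure state `∑ amp μ ν |μ ν⟩` of arbitrary finite local dimensions,
shared by a left and a right party. -/
structure Link where
  Left : Type
  Right : Type
  [fintypeLeft : Fintype Left]
  [fintypeRight : Fintype Right]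
  [decEqLeft : DecidableEq Left]
  [decEqRight : DecidableEq Right]
  amp : Matrix Left Right ℂ

attribute [instance] Link.fintypeLeft Link.fintypeRight Link.decEqLeft Link.decEqRight

/-- A local measurement, given by its Kraus operators: `∑ M†M = 1`. -/
def IsMeasurement {ι κ : Type} [Fintype ι] [DecidableEq ι] [Fintype κ] {k : ℕ}
    (M : Fin k → Matrix κ ι ℂ) : Prop :=
  ∑ α, (M α)ᴴ * M α = 1

/-- The completeness relation `∑_α conj(X^α_{μν}) X^α_{μ'ν'} = δ_{μμ'} δ_{νν'}` of the matrices of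
an entanglement swapping protocol. -/
def IsSwapping {ι κ : Type} [DecidableEq ι] [DecidableEq κ] {k : ℕ}
    (X : Fin k → Matrix ι κ ℂ) : Prop :=
  ∀ μ ν μ' ν', ∑ α, star (X α μ ν) * X α μ' ν' =
    (if μ = μ' then 1 else 0) * (if ν = ν' then 1 else 0)

/-- `Produces d L E`: a generic protocol, applied to the chain of links `L` (listed from A to B),
ends with the ensemble `E` of unnormalized `d × d` states between A and B. A protocol
consists of finitely many steps, each chosen depending on all earlier outcomes. A step is either
the swapping of two consecutive links by a measurement at the node between them, or a local
measurement on one link at its left or right end. Local measurements at both ends, in any number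
of rounds, form the LOCC conversions (purification protocols) of that link. -/
inductive Produces (d : ℕ) : List Link → List (Matrix (Fin d) (Fin d) ℂ) → Prop
  | done (A : Matrix (Fin d) (Fin d) ℂ) : Produces d [⟨Fin d, Fin d, A⟩] [A]
  | swap (pre post : List Link) (a b : Link) (k : ℕ) (X : Fin k → Matrix a.Right b.Left ℂ)
      (hX : IsSwapping X) (E : Fin k → List (Matrix (Fin d) (Fin d) ℂ))
      (hE : ∀ α, Produces d (pre ++ ⟨a.Left, b.Right, a.amp * X α * b.amp⟩ :: post) (E α)) :
      Produces d (pre ++ a :: b :: post) (List.ofFn E).flatten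
  | measureLeft (pre post : List Link) (a : Link) (κ : Type) [Fintype κ] [DecidableEq κ] (k : ℕ)
      (M : Fin k → Matrix κ a.Left ℂ) (hM : IsMeasurement M)
      (E : Fin k → List (Matrix (Fin d) (Fin d) ℂ))
      (hE : ∀ α, Produces d (pre ++ ⟨κ, a.Right, M α * a.amp⟩ :: post) (E α)) :
      Produces d (pre ++ a :: post) (List.ofFn E).flatten
  | measureRight (pre post : List Link) (a : Link) (κ : Type) [Fintype κ] [DecidableEq κ] (k : ℕ)
      (M : Fin k → Matrix κ a.Right ℂ) (hM : IsMeasurement M)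
      (E : Fin k → List (Matrix (Fin d) (Fin d) ℂ))
      (hE : ∀ α, Produces d (pre ++ ⟨a.Left, κ, a.amp * (M α)ᵀ⟩ :: post) (E α)) :
      Produces d (pre ++ a :: post) (List.ofFn E).flatten

/-- A parallel group of `m` links, seen as one link of the full dimension `d ^ m`. -/
def groupLink {m d : ℕ} (lam : Fin m → Fin d → ℝ) : Link :=
  ⟨Fin m → Fin d, Fin m → Fin d, sqrtDiag (kron lam)⟩

/-- The chain of the parallel groups. -/
def chain {n d : ℕ} (m : Fin (n + 1) → ℕ)
    (lam : (i : Fin (n + 1)) → Fin (m i) → Fin d → ℝ) : List Link :=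
  List.ofFn fun i => groupLink (lam i)

/-- Nested purification protocols for `a, b` in parallel, followed in series by `c, e` in parallel:
two independent swapping protocols, one on `a, c` and one on `b, e`, followed by an arbitrary
purification protocol on the two resulting links between A and B taken together. -/
def NestedProduces {d : ℕ} (a b c e : Fin d → ℝ) (E : List (Matrix (Fin d) (Fin d) ℂ)) : Prop :=
  ∃ (k l : ℕ) (X : Fin k → Matrix (Fin d) (Fin d) ℂ) (Y : Fin l → Matrix (Fin d) (Fin d) ℂ)
    (F : Fin k → Fin l → List (Matrix (Fin d) (Fin d) ℂ)),
    IsSwapping X ∧ IsSwapping Y ∧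
    (∀ α β, Produces d
      [⟨Fin d × Fin d, Fin d × Fin d,
        (sqrtDiag a * X α * sqrtDiag c) ⊗ₖ (sqrtDiag b * Y β * sqrtDiag e)⟩] (F α β)) ∧
    E = (List.ofFn fun α => (List.ofFn fun β => F α β).flatten).flatten

end DET

end

noncomputable section

namespace DET

/-! ### Decreasing rearrangement and the purification function -/

/-! The optimum rests on a quantity that no step of a protocol can increase on average, and that
deterministic purification and swapping saturate.

By homogeneity, an outcome `A` contributes `d |det A|^(2/d)` to the average G-concurrence
(`prob_mul_gConcurrence`). A positive semidefinite weight `W` at one end of a link is admissible if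
`det (B†WB) ≥ det (B†B)` for all `B` with `d` columns; the potential of a link `A` is the infimum of
`tr (W A A†)` over such weights. The inequality of arithmetic and geometric means bounds the
contribution of a final link by its potential. A measurement at the opposite end cannot raise the
summed potential, because the trace is linear and a single weight serves all outcomes.

The other steps need the symmetry `potential (A†A) = potential (A A†)` (`potential_gram_comm`),
which comes from a duality. For a spectrum `x`, diagonal weights bring the trace as close as desired
to `d (∏ P(x))^(1/d)` (`exists_admissible_diagonal`), and the purification measurement attains this
value as a sum of determinant roots (`exists_roof_eq`). By `roof_le_potential`, such sums lie below
every weighted trace at the other end. Symmetry then allows weights at both ends at once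
(`potential_le_two_sided`). Summed over a swapping family, the two-sided trace factors into one
trace for each of the two links (`sum_trace_swapping`), so swapping cannot raise the product of
potentials. Hence the average is at most the product of the potentials of the initial links
(`Produces.averageG_le`). For a parallel group the potential is at most `C_d` of the purified
vector, and `C_d` is multiplicative under the swapping function since determinants multiply.

The bound is attained. `P(x)`, continued by zeros, majorizes `x`, so Birkhoff's theorem yields a
measurement sending `diag(x)^(1/2)` to multiples of `diag(P(x))^(1/2)`, up to a row selection undone
at the other end. Swapping with clock-dressed Fourier matrices gives the same Schmidt vector in
every outcome, since the clock phases commute with diagonal matrices.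

A nested protocol is covered by the same bound, because the products `X ⊗ Y` form a swapping family
of the joined links. It is strictly worse when `a` and `e` are maximally entangled and `b`, `c` are
strongly peaked: both parallel groups purify to maximally entangled links, whereas nested swapping
amounts to local measurements on `c ⊗ b`, whose potential stays below one. -/

theorem exists_sorting_equiv {ι : Type} [Fintype ι] (x : ι → ℝ) :
    ∃ e : Fin (Fintype.card ι) ≃ ι, Antitone (x ∘ e) ∧
      ∀ l, desc x l = if h : l < Fintype.card ι then x (e ⟨l, h⟩) else 0 := by
  let e0 : Fin (Fintype.card ι) ≃ ι := (Fintype.equivFin ι).symm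
  let σ := Tuple.sort fun i => -x (e0 i)
  have hanti : Antitone (x ∘ (σ.trans e0)) := fun i j hij => by
    have := Tuple.monotone_sort (fun i => -x (e0 i)) hij
    simp only [Function.comp_apply] at this
    exact neg_le_neg_iff.mp this
  refine ⟨σ.trans e0, hanti, fun l => ?_⟩
  have hms : Finset.univ.val.map x = (List.ofFn (x ∘ (σ.trans e0)) : Multiset ℝ) := by
    rw [← Multiset.map_univ_val_equiv (σ.trans e0), Multiset.map_map, Fin.univ_val_map]
  have hsort : (Finset.univ.val.map x).sort (· ≥ ·) = List.ofFn (x ∘ (σ.trans e0)) := by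
    rw [hms, Multiset.coe_sort]
    apply List.mergeSort_of_pairwise
    simp_rw [decide_eq_true_eq]
    exact hanti.sortedGE_ofFn.pairwise
  unfold desc
  rw [hsort]
  split_ifs with h
  · rw [List.getD_eq_getElem _ _ (by simpa using h)]
    simp
  · exact List.getD_eq_default _ _ (by simpa using h)

theorem desc_antitone_nonneg {ι : Type} [Fintype ι] {x : ι → ℝ} (hx : ∀ i, 0 ≤ x i) :
    Antitone (desc x) ∧ ∀ l, 0 ≤ desc x l := by
  obtain ⟨e, he, hd⟩ := exists_sorting_equiv x
  refine ⟨fun a b hab => ?_, fun l => ?_⟩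
  · rw [hd, hd]
    split_ifs with h1 h2
    · exact he (show (⟨a, h2⟩ : Fin _) ≤ ⟨b, h1⟩ from hab)
    · omega
    · exact hx _
    · exact le_rfl
  · rw [hd]; split_ifs
    exacts [hx _, le_rfl]

theorem desc_comp_equiv {ι κ : Type} [Fintype ι] [Fintype κ] (x : ι → ℝ) (e : κ ≃ ι) :
    desc (x ∘ e) = desc x := by
  funext l
  unfold desc
  rw [← Multiset.map_map, Multiset.map_univ_val_equiv]

theorem desc_eq_self {d : ℕ} {y : Fin d → ℝ} (hy : Antitone y) (l : Fin d) : desc y l = y l := by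
  unfold desc
  rw [Fin.univ_val_map, Multiset.coe_sort, List.mergeSort_of_pairwise]
  · simp
  · simp_rw [decide_eq_true_eq]
    exact hy.sortedGE_ofFn.pairwise

theorem exists_perm_desc {d : ℕ} (y : Fin d → ℝ) :
    ∃ σ : Equiv.Perm (Fin d), ∀ l : Fin d, desc y l = y (σ l) := by
  obtain ⟨e, -, hd⟩ := exists_sorting_equiv y
  refine ⟨(finCongr (Fintype.card_fin d).symm).trans e, fun l => ?_⟩
  rw [hd, dif_pos (by simp)]
  rfl

theorem sum_desc_range {ι : Type} [Fintype ι] (x : ι → ℝ) :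
    ∑ l ∈ Finset.range (Fintype.card ι), desc x l = ∑ i, x i := by
  obtain ⟨e, -, hd⟩ := exists_sorting_equiv x
  rw [← e.sum_comp, Finset.sum_range]
  exact Finset.sum_congr rfl fun l _ => by rw [hd, dif_pos l.2]

theorem remainder_comp_equiv {ι κ : Type} [Fintype ι] [Fintype κ] (d : ℕ) (x : ι → ℝ)
    (e : κ ≃ ι) (l : ℕ) : remainder d (x ∘ e) l = remainder d x l := by
  induction l with
  | zero => exact e.sum_comp x
  | succ l ih => simp only [remainder, ih, desc_comp_equiv]

theorem purifyFun_comp_equiv {ι κ : Type} [Fintype ι] [Fintype κ] (d : ℕ) (x : ι → ℝ)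
    (e : κ ≃ ι) : purifyFun d (x ∘ e) = purifyFun d x := by
  funext l
  simp only [purifyFun, desc_comp_equiv, remainder_comp_equiv]

/-- The recursion for the purification function copies the largest entries and then spreads
the remaining weight uniformly. -/
theorem remainder_structure {ι : Type} [Fintype ι] {d : ℕ} (hd : 0 < d)
    (hcard : d ≤ Fintype.card ι) {x : ι → ℝ} (hx : ∀ i, 0 ≤ x i) :
    ∃ (j : ℕ) (t : ℝ), j < d ∧ 0 ≤ t ∧
      (∀ l : Fin d, (l : ℕ) < j → purifyFun d x l = desc x l) ∧
      (∀ l : Fin d, j ≤ (l : ℕ) → purifyFun d x l = t) ∧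
      (∀ l < j, t ≤ desc x l) ∧ desc x j ≤ t ∧
      ∑ l ∈ Finset.Ico j (Fintype.card ι), desc x l = ((d : ℝ) - j) * t := by
  obtain ⟨hanti, hnn⟩ := desc_antitone_nonneg hx
  set y := desc x with hy
  set N := Fintype.card ι
  set s := remainder d x with hs
  -- The recursion changes regime at the first `l` where the mean of the remaining weight wins. The
  -- clause `l + 1 = d` makes the search succeed; at that index the divisor is one, so the mean is
  -- the whole remainder and wins as well.
  have hex : ∃ l, l + 1 = d ∨ y l ≤ s l / ((d : ℝ) - l) := ⟨d - 1, Or.inl (by omega)⟩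
  classical
  let j := Nat.find hex
  have hj : j + 1 = d ∨ y j ≤ s j / ((d : ℝ) - j) := Nat.find_spec hex
  have hmin : ∀ l < j, ¬ (l + 1 = d ∨ y l ≤ s l / ((d : ℝ) - l)) := fun l hl => Nat.find_min hex hl
  have hjd : j < d := by
    have : j ≤ d - 1 := Nat.find_min' hex (Or.inl (by omega))
    omega
  have hlt : ∀ l < j, s l / ((d : ℝ) - l) < y l := fun l hl => by
    have := hmin l hl
    push Not at this
    exact this.2
  have hpre : ∀ l ≤ j, s l = ∑ i ∈ Finset.Ico l N, y i := by
    intro l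
    induction l with
    | zero =>
      intro _
      rw [Nat.Ico_zero_eq_range, hy, sum_desc_range]
      rfl
    | succ l ih =>
      intro hl
      have h1 : s (l + 1) = s l - max (y l) (s l / ((d : ℝ) - l)) := rfl
      rw [h1, max_eq_left (hlt l hl).le, ih (by omega),
        Finset.sum_eq_sum_Ico_succ_bot (by omega : l < N)]
      ring
  have hpos : (0 : ℝ) < (d : ℝ) - j := by
    have : (j : ℝ) < d := by exact_mod_cast hjd
    linarith
  set t := s j / ((d : ℝ) - j) with ht
  have hsj : s j = ((d : ℝ) - j) * t := by rw [ht]; field_simp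
  have hsnn : 0 ≤ s j := by
    rw [hpre j le_rfl]
    exact Finset.sum_nonneg fun i _ => hnn i
  have hyt : y j ≤ t := by
    rcases hj with h | h
    · have h1 : (d : ℝ) - j = 1 := by
        have : ((j : ℝ) + 1) = d := by exact_mod_cast h
        linarith
      rw [ht, h1, div_one, hpre j le_rfl]
      exact Finset.single_le_sum (f := y) (fun i _ => hnn i)
        (Finset.mem_Ico.mpr ⟨le_rfl, by omega⟩)
    · exact h
  have hpost : ∀ k, j + k < d → s (j + k) = ((d : ℝ) - (j + k : ℕ)) * t := by
    intro k
    induction k with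
    | zero => intro _; simpa using hsj
    | succ k ih =>
      intro hk
      have h1 : s (j + k + 1) = s (j + k) - max (y (j + k)) (s (j + k) / ((d : ℝ) - (j + k : ℕ))) :=
        rfl
      have h2 : (0 : ℝ) < (d : ℝ) - (j + k : ℕ) := by
        have : ((j + k : ℕ) : ℝ) < d := by exact_mod_cast (by omega : j + k < d)
        linarith
      rw [← add_assoc, h1, ih (by omega), mul_div_cancel_left₀ _ h2.ne',
        max_eq_right ((hanti (by omega : j ≤ j + k)).trans hyt)]
      push_cast
      ring
  -- Going backwards from `j`: removing an entry above the mean lowers the mean of the rest. So the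
  -- final mean `t` is below every earlier mean, hence below every copied entry.
  have hmean : ∀ k, k ≤ j → t ≤ s (j - k) / ((d : ℝ) - (j - k : ℕ)) := by
    intro k
    induction k with
    | zero => intro _; simp [ht]
    | succ k ih =>
      intro hk
      refine (ih (by omega)).trans ?_
      have hl := hlt (j - (k + 1)) (by omega)
      have h1 : s (j - k) = s (j - (k + 1)) - y (j - (k + 1)) := by
        have h3 : j - k = j - (k + 1) + 1 := by omega
        have h2 : s (j - (k + 1) + 1) = s (j - (k + 1)) - max (y (j - (k + 1)))
          (s (j - (k + 1)) / ((d : ℝ) - (j - (k + 1) : ℕ))) := rfl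
        rw [h3, h2, max_eq_left hl.le]
      have h4 : ((j - k : ℕ) : ℝ) = ((j - (k + 1) : ℕ) : ℝ) + 1 := by
        exact_mod_cast (by omega : j - k = j - (k + 1) + 1)
      have h5 : ((j - k : ℕ) : ℝ) < d := by exact_mod_cast (by omega : j - k < d)
      rw [h1]
      rw [h4] at h5 ⊢
      generalize ((j - (k + 1) : ℕ) : ℝ) = a at *
      rw [div_lt_iff₀ (by linarith)] at hl
      rw [div_le_div_iff₀ (by linarith) (by linarith)]
      nlinarith
  refine ⟨j, t, hjd, div_nonneg hsnn hpos.le, fun l hl => max_eq_left (hlt l hl).le,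
    fun l hl => ?_, fun l hl => ?_, hyt, ?_⟩
  · obtain ⟨k, hk⟩ := Nat.exists_eq_add_of_le hl
    have h2 : (0 : ℝ) < (d : ℝ) - (l : ℕ) := by
      have : ((l : ℕ) : ℝ) < d := by exact_mod_cast l.2
      linarith
    have h3 := hpost k (hk ▸ l.2)
    rw [← hk] at h3
    change max (y l) (s l / ((d : ℝ) - (l : ℕ))) = t
    rw [h3, mul_div_cancel_left₀ _ h2.ne', max_eq_right ((hanti hl).trans hyt)]
  · have := hmean (j - l) (by omega)
    rw [show j - (j - l) = l by omega] at this
    exact this.trans (hlt l hl).le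
  · rw [← hpre j le_rfl, hsj]

theorem purifyFun_antitone_nonneg {ι : Type} [Fintype ι] {d : ℕ} (hd : 0 < d)
    (hcard : d ≤ Fintype.card ι) {x : ι → ℝ} (hx : ∀ i, 0 ≤ x i) :
    Antitone (purifyFun d x) ∧ ∀ l, 0 ≤ purifyFun d x l := by
  obtain ⟨j, t, -, ht, h1, h2, h3, -, -⟩ := remainder_structure hd hcard hx
  obtain ⟨hanti, hnn⟩ := desc_antitone_nonneg hx
  refine ⟨fun a b hab => ?_, fun l => ?_⟩
  · have hab' : (a : ℕ) ≤ b := hab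
    rcases lt_or_ge (b : ℕ) j with hb | hb
    · rw [h1 b hb, h1 a (by omega)]
      exact hanti hab
    · rw [h2 b hb]
      rcases lt_or_ge (a : ℕ) j with ha | ha
      · rw [h1 a ha]; exact h3 _ ha
      · rw [h2 a ha]
  · rcases lt_or_ge (l : ℕ) j with hb | hb
    · rw [h1 l hb]; exact hnn _
    · rw [h2 l hb]; exact ht

/-- The structure of the purification function in terms of the original index set: the entries
in `J` are copied from `x`, the others equal the mean `t` of the rest, which bounds the
rest of `x`. -/
theorem purifyFun_structure {ι : Type} [Fintype ι] [DecidableEq ι] {d : ℕ} (hd : 0 < d)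
    (hcard : d ≤ Fintype.card ι) {x : ι → ℝ} (hx : ∀ i, 0 ≤ x i) :
    ∃ (e : Fin d ↪ ι) (J : Finset (Fin d)) (t : ℝ), Jᶜ.Nonempty ∧ 0 ≤ t ∧
      (∀ l ∈ J, purifyFun d x l = x (e l) ∧ t ≤ x (e l)) ∧
      (∀ l ∉ J, purifyFun d x l = t) ∧
      (∀ i ∉ J.map e, x i ≤ t) ∧
      ∑ i ∈ (J.map e)ᶜ, x i = Jᶜ.card * t := by
  obtain ⟨j, t, hjd, ht, h1, h2, h3, h4, h5⟩ := remainder_structure hd hcard hx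
  obtain ⟨hanti, hnn⟩ := desc_antitone_nonneg hx
  obtain ⟨s, hs, hds⟩ := exists_sorting_equiv x
  let e : Fin d ↪ ι := (Fin.castLEEmb hcard).trans s.toEmbedding
  have he : ∀ l : Fin d, desc x l = x (e l) := fun l => by
    rw [hds, dif_pos (l.2.trans_le hcard)]; rfl
  let J : Finset (Fin d) := Finset.univ.filter fun l => (l : ℕ) < j
  have hcJ : J.card = j := by
    simp [J, Fin.card_filter_val_lt, hjd.le]
  have hsum : ∑ i ∈ J.map e, x i = ∑ l ∈ Finset.range j, desc x l := by
    rw [Finset.sum_map]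
    refine Finset.sum_bij (fun l _ => (l : ℕ)) (fun l hl => by simpa [J] using hl)
      (fun a _ b _ hab => Fin.ext hab) (fun b hb => ?_) (fun l _ => (he l).symm)
    rw [Finset.mem_range] at hb
    exact ⟨⟨b, hb.trans hjd⟩, by simpa [J] using hb, rfl⟩
  refine ⟨e, J, t, ⟨⟨j, hjd⟩, by simp [J]⟩, ht, fun l hl => ?_, fun l hl => ?_, fun i hi => ?_, ?_⟩
  · have hl' : (l : ℕ) < j := by simpa [J] using hl
    exact ⟨(h1 l hl').trans (he l), (he l) ▸ h3 l hl'⟩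
  · exact h2 l (by simpa [J] using hl)
  · obtain ⟨k, rfl⟩ := s.surjective i
    have hk : j ≤ (k : ℕ) := by
      by_contra hlt
      push Not at hlt
      exact hi (Finset.mem_map.mpr ⟨⟨k, hlt.trans hjd⟩, by simpa [J] using hlt, rfl⟩)
    have := hds k
    rw [dif_pos k.2] at this
    rw [← this]
    exact (hanti hk).trans h4
  · have h6 := Finset.sum_add_sum_compl (J.map e) x
    have h7 := Finset.sum_range_add_sum_Ico (desc x) (hjd.le.trans hcard)
    rw [sum_desc_range] at h7
    rw [Finset.card_compl, hcJ, Fintype.card_fin, Nat.cast_sub hjd.le]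
    linarith

theorem purifyFun_sum {ι : Type} [Fintype ι] {d : ℕ} (hd : 0 < d)
    (hcard : d ≤ Fintype.card ι) {x : ι → ℝ} (hx : ∀ i, 0 ≤ x i) :
    ∑ l, purifyFun d x l = ∑ i, x i := by
  classical
  obtain ⟨e, J, t, -, -, h1, h2, -, h3⟩ := purifyFun_structure hd hcard hx
  rw [← Finset.sum_add_sum_compl J, ← Finset.sum_add_sum_compl (J.map e), h3, Finset.sum_map,
    Finset.sum_congr rfl fun l hl => (h1 l hl).1,
    Finset.sum_congr rfl fun l hl => h2 l (Finset.mem_compl.mp hl)]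
  simp

/-! ### Purification measurements -/

/-- The entries of the purification function, placed at the positions `e` and continued by zeros,
majorize `x`: by Birkhoff's theorem `x` is a mixture of rearrangements of them. -/
theorem exists_perm_mixture {ι : Type} [Fintype ι] [DecidableEq ι] {d : ℕ} (hd : 0 < d)
    (hcard : d ≤ Fintype.card ι) {x : ι → ℝ} (hx : ∀ i, 0 ≤ x i) :
    ∃ (e : Fin d ↪ ι) (p : Equiv.Perm ι → ℝ), (∀ σ, 0 ≤ p σ) ∧ ∑ σ, p σ = 1 ∧
      ∀ i, ∑ σ, p σ * (∑ l, if e l = σ i then purifyFun d x l else 0) = x i := by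
  obtain ⟨e, J, t, hJ, ht, h1, h2, h3, h4⟩ := purifyFun_structure hd hcard hx
  -- `T` holds the copied entries, `U` the entries equal to the mean `t`, and `Z` the padding zeros.
  set T := J.map e with hT
  set U := Jᶜ.map e with hU
  set Z := (Finset.univ.map e)ᶜ with hZ
  have hcU : U.card = Jᶜ.card := Finset.card_map _
  have hr : (0 : ℝ) < Jᶜ.card := by exact_mod_cast hJ.card_pos
  have hmemTU : ∀ i, i ∈ T → i ∉ U := by
    intro i hi hi'
    obtain ⟨a, ha, rfl⟩ := Finset.mem_map.mp hi
    obtain ⟨b, hb, hab⟩ := Finset.mem_map.mp hi'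
    rw [e.injective hab] at hb
    exact Finset.mem_compl.mp hb ha
  have hmemTZ : ∀ i, i ∈ T → i ∉ Z := by
    intro i hi hi'
    obtain ⟨a, ha, rfl⟩ := Finset.mem_map.mp hi
    simp [hZ] at hi'
  have hcover : ∀ i, i ∉ T → (i ∈ U ↔ i ∉ Z) := by
    intro i hi
    constructor
    · intro hi' hz
      obtain ⟨a, ha, rfl⟩ := Finset.mem_map.mp hi'
      simp [hZ] at hz
    · intro hz
      rw [hZ, Finset.mem_compl, not_not] at hz
      obtain ⟨a, -, rfl⟩ := Finset.mem_map.mp hz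
      refine Finset.mem_map.mpr ⟨a, ?_, rfl⟩
      rw [Finset.mem_compl]
      exact fun ha => hi (Finset.mem_map.mpr ⟨a, ha, rfl⟩)
  set y : ι → ℝ := fun i => ∑ l, if e l = i then purifyFun d x l else 0 with hy
  have hye : ∀ l, y (e l) = purifyFun d x l := fun l => by
    simp [hy, e.injective.eq_iff]
  have hyT : ∀ i ∈ T, y i = x i := by
    intro i hi
    obtain ⟨a, ha, rfl⟩ := Finset.mem_map.mp hi
    rw [hye, (h1 a ha).1]
  have hyU : ∀ i ∈ U, y i = t := by
    intro i hi
    obtain ⟨a, ha, rfl⟩ := Finset.mem_map.mp hi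
    rw [hye, h2 a (Finset.mem_compl.mp ha)]
  have hyZ : ∀ i ∈ Z, y i = 0 := by
    intro i hi
    refine Finset.sum_eq_zero fun l _ => if_neg ?_
    rintro rfl
    simp [hZ] at hi
  suffices h : ∃ B ∈ doublyStochastic ℝ ι, ∀ i, ∑ k, B i k * y k = x i by
    obtain ⟨B, hB, hBx⟩ := h
    obtain ⟨p, hp, hp1, hpB⟩ := exists_eq_sum_perm_of_mem_doublyStochastic hB
    refine ⟨e, p, hp, hp1, fun i => ?_⟩
    rw [← hBx i, ← hpB]
    simp only [Matrix.sum_apply, Matrix.smul_apply, Finset.sum_mul, smul_eq_mul]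
    rw [Finset.sum_comm]
    refine Finset.sum_congr rfl fun σ _ => ?_
    simp [Equiv.Perm.permMatrix, PEquiv.toMatrix_apply, hy]
  -- If `t = 0` then `x` vanishes off `T` and already equals the padded vector, so the identity
  -- matrix serves.
  rcases ht.eq_or_lt with ht0 | htpos
  · refine ⟨1, one_mem _, fun i => ?_⟩
    rw [Finset.sum_eq_single i (fun k _ hk => by simp [Matrix.one_apply_ne hk.symm]) (by simp)]
    rw [Matrix.one_apply_eq, one_mul]
    by_cases hi : i ∈ T
    · exact hyT i hi
    · have hxi : x i = 0 := le_antisymm ((h3 i hi).trans ht0.ge) (hx i)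
      rw [hxi]
      by_cases hz : i ∈ Z
      · exact hyZ i hz
      · rw [hyU i ((hcover i hi).mpr hz), ← ht0]
  · have hcT : (Tᶜ.card : ℝ) = Jᶜ.card + Z.card := by
      have h5 : T.card = J.card := Finset.card_map _
      have h6 := Finset.card_le_univ J
      rw [Fintype.card_fin] at h6
      have h7 : Z.card = Fintype.card ι - d := by
        rw [hZ, Finset.card_compl, Finset.card_map, Finset.card_univ, Fintype.card_fin]
      rw [Finset.card_compl T, Finset.card_compl J, h5, h7, Fintype.card_fin]
      have h8 : Fintype.card ι - J.card = d - J.card + (Fintype.card ι - d) := by omega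
      exact_mod_cast h8
    -- Without padding zeros, the bound `x i ≤ t` and the value of the sum force equality. This
    -- keeps the row sums right when the division by `Z.card` takes its default value.
    have hfull : ∀ i ∉ T, Z.card = 0 → x i = t := by
      intro i hi hz
      have h5 : ∑ i ∈ Tᶜ, x i = ∑ i ∈ Tᶜ, t := by
        rw [h4, Finset.sum_const, nsmul_eq_mul, hcT, hz]
        simp
      exact (Finset.sum_eq_sum_iff_of_le fun i hi => h3 i (Finset.mem_compl.mp hi)).mp h5 i
        (Finset.mem_compl.mpr hi)
    have hsplit : ∀ i ∉ T, ∀ f : ι → ℝ, ∑ k, (if k ∈ U then x i / (Jᶜ.card * t) else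
        if k ∈ Z then (1 - x i / t) / Z.card else 0) * f k =
        (∑ k ∈ U, f k) * (x i / (Jᶜ.card * t)) + (∑ k ∈ Z, f k) * ((1 - x i / t) / Z.card) := by
      intro i _ f
      have h7 : ∀ k, (if k ∈ U then x i / (Jᶜ.card * t) else
        if k ∈ Z then (1 - x i / t) / Z.card else 0) * f k =
        (if k ∈ U then f k * (x i / (Jᶜ.card * t)) else 0) +
        (if k ∈ Z then f k * ((1 - x i / t) / Z.card) else 0) := by
        intro k
        by_cases hu : k ∈ U
        · have hz : k ∉ Z := (hcover k fun hk => hmemTU k hk hu).mp hu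
          simp [hu, hz, mul_comm]
        · by_cases hz : k ∈ Z <;> simp [hu, hz, mul_comm]
      rw [Finset.sum_congr rfl fun k _ => h7 k, Finset.sum_add_distrib, Finset.sum_ite_mem,
        Finset.sum_ite_mem, Finset.univ_inter, Finset.univ_inter, Finset.sum_mul, Finset.sum_mul]
    -- A row off `T` puts mass `x i / t` uniformly on `U` and the remaining `1 - x i / t` uniformly
    -- on `Z`, so it averages the padded vector to `x i`. The columns sum to one because the sum of
    -- `x` off `T` is `Jᶜ.card * t`.
    refine ⟨Matrix.of fun i k => if i ∈ T then (if i = k then 1 else 0) else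
      if k ∈ U then x i / (Jᶜ.card * t) else if k ∈ Z then (1 - x i / t) / Z.card else 0, ?_, ?_⟩
    · rw [mem_doublyStochastic_iff_sum]
      simp only [Matrix.of_apply]
      refine ⟨fun i k => ?_, fun i => ?_, fun k => ?_⟩
      · by_cases hi : i ∈ T
        · simp only [hi, if_true]; split_ifs <;> norm_num
        · have h8 : x i / t ≤ 1 := (div_le_one htpos).mpr (h3 i hi)
          simp only [hi, if_false]
          split_ifs
          · exact div_nonneg (hx i) (by positivity)
          · exact div_nonneg (by linarith) (by positivity)
          · exact le_rfl
      · by_cases hi : i ∈ T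
        · simp [hi]
        · have h9 := hsplit i hi fun _ => 1
          simp only [mul_one] at h9
          simp only [hi, if_false]
          rw [h9]
          simp only [Finset.sum_const, nsmul_eq_mul, mul_one, hcU]
          rcases Nat.eq_zero_or_pos Z.card with hz | hz
          · rw [hfull i hi hz, hz]
            simp
            field_simp
          · have hz' : (0 : ℝ) < Z.card := by exact_mod_cast hz
            field_simp
            ring
      · by_cases hk : k ∈ T
        · have hkU := hmemTU k hk
          have hkZ := hmemTZ k hk
          rw [Finset.sum_eq_single k]
          · simp [hk]
          · intro b _ hb
            simp [hkU, hkZ, hb]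
          · simp
        · have h10 : ∀ i, (if i ∈ T then (if i = k then (1 : ℝ) else 0) else
              if k ∈ U then x i / (Jᶜ.card * t) else if k ∈ Z then (1 - x i / t) / Z.card else 0) =
              if i ∈ Tᶜ then (if k ∈ U then x i / (Jᶜ.card * t) else (1 - x i / t) / Z.card)
              else 0 := by
            intro i
            by_cases hi : i ∈ T
            · have : i ≠ k := fun h => hk (h ▸ hi)
              simp [hi, this]
            · by_cases hu : k ∈ U
              · simp [hi, hu]
              · have : k ∈ Z := by
                  by_contra hz
                  exact hu ((hcover k hk).mpr hz)
                simp [hi, hu, this]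
          rw [Finset.sum_congr rfl fun i _ => h10 i, Finset.sum_ite_mem, Finset.univ_inter]
          by_cases hu : k ∈ U
          · simp only [hu, if_true]
            rw [← Finset.sum_div, h4]
            field_simp
          · simp only [hu, if_false]
            have hkZ : k ∈ Z := by
              by_contra hz
              exact hu ((hcover k hk).mpr hz)
            have hz' : (0 : ℝ) < Z.card := by exact_mod_cast Finset.card_pos.mpr ⟨k, hkZ⟩
            rw [← Finset.sum_div, Finset.sum_sub_distrib, ← Finset.sum_div, h4, Finset.sum_const,
              nsmul_eq_mul, hcT, mul_div_cancel_right₀ _ htpos.ne', mul_one, add_sub_cancel_left,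
              div_self hz'.ne']
    · intro i
      simp only [Matrix.of_apply]
      by_cases hi : i ∈ T
      · simp [hi, hyT i hi]
      · simp only [hi, if_false]
        rw [hsplit i hi y, Finset.sum_congr rfl hyU, Finset.sum_congr rfl hyZ]
        simp only [Finset.sum_const, nsmul_eq_mul, hcU]
        rw [mul_zero, zero_mul, add_zero]
        field_simp

/-! ### Measurements built from row selections -/

theorem IsMeasurement.of_fintype {ι κ τ : Type} [Fintype ι] [DecidableEq ι] [Fintype κ] [Fintype τ]
    {M : τ → Matrix κ ι ℂ} (hM : ∑ a, (M a)ᴴ * M a = 1) :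
    IsMeasurement fun a : Fin (Fintype.card τ) => M ((Fintype.equivFin τ).symm a) := by
  unfold IsMeasurement
  rw [← hM]
  exact (Fintype.equivFin τ).symm.sum_comp fun a => (M a)ᴴ * M a

/-- The selection of the rows with indices `s`. -/
def selection {d : ℕ} {ι : Type} [DecidableEq ι] (s : Fin d ↪ ι) : Matrix (Fin d) ι ℂ :=
  Matrix.of fun l i => if s l = i then 1 else 0

theorem selection_mul_conjTranspose {d : ℕ} {ι : Type} [Fintype ι] [DecidableEq ι]
    (s : Fin d ↪ ι) : selection s * (selection s)ᴴ = 1 := by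
  ext l l'
  simp [selection, Matrix.mul_apply, Matrix.one_apply, apply_ite, s.injective.eq_iff, eq_comm]

theorem selection_mul_transpose {d : ℕ} {ι : Type} [Fintype ι] [DecidableEq ι]
    (s : Fin d ↪ ι) : selection s * (selection s)ᵀ = 1 := by
  ext l l'
  simp [selection, Matrix.mul_apply, Matrix.one_apply, s.injective.eq_iff, eq_comm]

theorem sum_single_diagonal {ι : Type} [Fintype ι] [DecidableEq ι] (v : ι → ℂ) :
    ∑ i, Matrix.single i i (v i) = Matrix.diagonal v := by
  ext a b
  rw [Matrix.sum_apply, Finset.sum_eq_single a (fun i _ hi => by simp [hi])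
    (by simp)]
  simp [Matrix.single_apply, Matrix.diagonal_apply]

theorem selection_conjTranspose_mul_diagonal {d : ℕ} {ι : Type} [Fintype ι] [DecidableEq ι]
    (s : Fin d ↪ ι) (v : Fin d → ℂ) :
    (selection s)ᴴ * Matrix.diagonal v * selection s =
      Matrix.diagonal fun i => ∑ l, if s l = i then v l else 0 := by
  ext i i'
  rw [Matrix.mul_apply]
  simp only [selection, Matrix.mul_diagonal, Matrix.conjTranspose_apply, Matrix.of_apply]
  by_cases h : i = i'
  · subst h
    rw [Matrix.diagonal_apply_eq]
    refine Finset.sum_congr rfl fun l _ => ?_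
    split_ifs <;> simp
  · rw [Matrix.diagonal_apply_ne _ h]
    refine Finset.sum_eq_zero fun l _ => ?_
    by_cases h1 : s l = i
    · have : s l ≠ i' := fun h2 => h (h1.symm.trans h2)
      simp [this]
    · simp [h1]

/-- A row selection extends to a measurement all of whose other outcomes annihilate it. -/
theorem exists_selection_measurement {d : ℕ} (hd : 0 < d) {ι : Type} [Fintype ι] [DecidableEq ι]
    (s : Fin d ↪ ι) : ∃ (k : ℕ) (M : Fin k → Matrix (Fin d) ι ℂ), IsMeasurement M ∧
      ∀ a, selection s * (M a)ᵀ = 1 ∨ selection s * (M a)ᵀ = 0 := by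
  -- Each index outside the range of `s` gets an outcome of its own, sent to the first basis vector;
  -- this completes the projection onto the range to the identity.
  let M : Option ι → Matrix (Fin d) ι ℂ := fun a => a.elim (selection s) fun i =>
    if i ∈ Set.range s then 0 else Matrix.single ⟨0, hd⟩ i 1
  refine ⟨_, _, IsMeasurement.of_fintype (M := M) ?_, fun a => ?_⟩
  · rw [Fintype.sum_option]
    have h1 := selection_conjTranspose_mul_diagonal s 1
    rw [show (Matrix.diagonal 1 : Matrix (Fin d) (Fin d) ℂ) = 1 from Matrix.diagonal_one,
      Matrix.mul_one] at h1
    have h2 : ∀ i, (M (some i))ᴴ * M (some i) =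
        Matrix.single i i (if i ∈ Set.range s then 0 else 1) := by
      intro i
      by_cases hi : i ∈ Set.range s
      · simp only [M, Option.elim_some, if_pos hi]; simp
      · simp only [M, Option.elim_some, if_neg hi]; simp
    rw [show M none = selection s from rfl, h1, Finset.sum_congr rfl fun i _ => h2 i,
      sum_single_diagonal, Matrix.diagonal_add, ← Matrix.diagonal_one]
    congr 1
    funext i
    by_cases hi : i ∈ Set.range s
    · obtain ⟨l, rfl⟩ := hi
      simp [s.injective.eq_iff]
    · have : ∀ l, s l ≠ i := fun l hl => hi ⟨l, hl⟩
      simp [this]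
  · rcases (Fintype.equivFin (Option ι)).symm a with _ | i
    · exact Or.inl (selection_mul_transpose s)
    · right
      change selection s * (if i ∈ Set.range s then (0 : Matrix (Fin d) ι ℂ) else Matrix.single ⟨0, hd⟩ i 1)ᵀ = 0
      split_ifs with hi
      · simp
      · ext l l'
        rw [Matrix.transpose_single, Matrix.mul_apply]
        simp only [selection, Matrix.of_apply, Matrix.single_apply, Matrix.zero_apply]
        refine Finset.sum_eq_zero fun j _ => ?_
        by_cases hj : s l = j
        · have : ¬ (i = j ∧ (⟨0, hd⟩ : Fin d) = l') := fun h => hi ⟨l, hj.trans h.1.symm⟩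
          rw [if_neg this, mul_zero]
        · simp [hj]

theorem sqrtDiag_mul_sqrtDiag {ι : Type} [Fintype ι] [DecidableEq ι] {x : ι → ℝ}
    (hx : ∀ i, 0 ≤ x i) :
    sqrtDiag x * sqrtDiag x = Matrix.diagonal fun i => ((x i : ℝ) : ℂ) := by
  simp only [sqrtDiag, Matrix.diagonal_mul_diagonal]
  congr 1
  funext i
  rw [← Complex.ofReal_mul, Real.mul_self_sqrt (hx i)]

theorem sqrtDiag_conjTranspose {ι : Type} [DecidableEq ι] (x : ι → ℝ) :
    (sqrtDiag x)ᴴ = sqrtDiag x := by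
  simp [sqrtDiag, Matrix.diagonal_conjTranspose, Pi.star_def]

/-- A measurement at one end that converts `diag(x)^{1/2}`, up to scalars and selections, into
`diag(P(x))^{1/2}` with certainty. -/
theorem exists_purification_measurement {ι : Type} [Fintype ι] [DecidableEq ι] {d : ℕ} (hd : 0 < d)
    (hcard : d ≤ Fintype.card ι) {x : ι → ℝ} (hx : ∀ i, 0 ≤ x i) :
    ∃ (k : ℕ) (M : Fin k → Matrix (Fin d) ι ℂ) (c : Fin k → ℝ) (s : Fin k → (Fin d ↪ ι)),
      IsMeasurement M ∧ ∑ a, c a ^ 2 = 1 ∧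
      ∀ a, M a * sqrtDiag x = (c a : ℂ) • (sqrtDiag (purifyFun d x) * selection (s a)) := by
  obtain ⟨e, p, hp, hp1, hmix⟩ := exists_perm_mixture hd hcard hx
  have hPnn := (purifyFun_antitone_nonneg hd hcard hx).2
  -- In the rearrangement by `σ`, the entry `l` of the purified vector sits at `σ⁻¹ (e l)`.
  let S : Equiv.Perm ι → (Fin d ↪ ι) := fun σ => e.trans σ.symm.toEmbedding
  have hS : ∀ σ l i, S σ l = i ↔ e l = σ i := fun σ l i => by
    simp [S, Equiv.symm_apply_eq]
  -- One Kraus operator per permutation of the Birkhoff mixture: divide by `√x`, select, multiply by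
  -- the target. The Gram matrices add up to the mixture divided by `x`, which is the identity on
  -- the support of `x`. As `0⁻¹ = 0`, they miss the kernel, which the second kind of outcome in `M`
  -- supplies.
  let A : Equiv.Perm ι → Matrix (Fin d) ι ℂ := fun σ => ((Real.sqrt (p σ) : ℝ) : ℂ) •
    (sqrtDiag (purifyFun d x) * selection (S σ) * sqrtDiag fun i => (x i)⁻¹)
  let M : Equiv.Perm ι ⊕ ι → Matrix (Fin d) ι ℂ :=
    Sum.elim A fun i => if x i = 0 then Matrix.single ⟨0, hd⟩ i 1 else 0
  let c : Equiv.Perm ι ⊕ ι → ℝ := Sum.elim (fun σ => Real.sqrt (p σ)) fun _ => 0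
  let s : Equiv.Perm ι ⊕ ι → (Fin d ↪ ι) := Sum.elim S fun _ => e
  have hA : ∀ σ, (A σ)ᴴ * A σ = Matrix.diagonal fun i =>
      ((p σ * (∑ l, if e l = σ i then purifyFun d x l else 0) * (x i)⁻¹ : ℝ) : ℂ) := by
    intro σ
    have h1 : (A σ)ᴴ * A σ = ((p σ : ℝ) : ℂ) • ((sqrtDiag fun i => (x i)⁻¹) *
        ((selection (S σ))ᴴ * (sqrtDiag (purifyFun d x) * sqrtDiag (purifyFun d x)) *
        selection (S σ)) * (sqrtDiag fun i => (x i)⁻¹)) := by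
      simp only [A, Matrix.conjTranspose_smul, Matrix.conjTranspose_mul, sqrtDiag_conjTranspose,
        Matrix.smul_mul, Matrix.mul_smul, smul_smul, Matrix.mul_assoc]
      congr 1
      rw [Complex.star_def, Complex.conj_ofReal, ← Complex.ofReal_mul, Real.mul_self_sqrt (hp σ)]
    rw [h1, sqrtDiag_mul_sqrtDiag hPnn, selection_conjTranspose_mul_diagonal, sqrtDiag,
      Matrix.diagonal_mul_diagonal, Matrix.diagonal_mul_diagonal, ← Matrix.diagonal_smul]
    congr 1
    funext i
    simp only [Pi.smul_apply, smul_eq_mul, hS]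
    rw [mul_right_comm (((Real.sqrt (x i)⁻¹ : ℝ) : ℂ)), ← Complex.ofReal_mul,
      Real.mul_self_sqrt (inv_nonneg.mpr (hx i))]
    push_cast
    simp only [apply_ite (fun r : ℝ => (r : ℂ)), Complex.ofReal_zero]
    ring
  have hM : ∑ a, (M a)ᴴ * M a = 1 := by
    rw [Fintype.sum_sum_type]
    have h2 : ∀ i, (M (Sum.inr i))ᴴ * M (Sum.inr i) =
        Matrix.single i i (if x i = 0 then 1 else 0) := by
      intro i
      by_cases hi : x i = 0
      · simp only [M, Sum.elim_inr, if_pos hi]; simp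
      · simp only [M, Sum.elim_inr, if_neg hi]; simp
    have h2' : ∀ σ, (M (Sum.inl σ))ᴴ * M (Sum.inl σ) = _ := hA
    rw [Finset.sum_congr rfl fun σ _ => h2' σ, Finset.sum_congr rfl fun i _ => h2 i,
      sum_single_diagonal]
    ext i i'
    rw [Matrix.add_apply, Matrix.sum_apply]
    by_cases h : i = i'
    · subst h
      simp only [Matrix.diagonal_apply_eq, Matrix.one_apply_eq]
      rw [← Complex.ofReal_sum, ← Finset.sum_mul, hmix]
      by_cases hi : x i = 0
      · simp [hi]
      · simp [hi]
    · simp [h]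
  have hc : ∑ a, c a ^ 2 = 1 := by
    rw [Fintype.sum_sum_type]
    simp [c, Real.sq_sqrt (hp _), hp1]
  have hMx : ∀ a, M a * sqrtDiag x =
      (c a : ℂ) • (sqrtDiag (purifyFun d x) * selection (s a)) := by
    rintro (σ | i)
    · change A σ * sqrtDiag x = ((Real.sqrt (p σ) : ℝ) : ℂ) •
        (sqrtDiag (purifyFun d x) * selection (S σ))
      ext l i
      simp only [A, Matrix.smul_apply, sqrtDiag,
        Matrix.mul_diagonal, Matrix.diagonal_mul, selection, Matrix.of_apply, smul_eq_mul]
      by_cases hl : S σ l = i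
      · simp only [if_pos hl]
        by_cases hi : x i = 0
        -- Where `x i = 0`, the mixture is a vanishing sum of nonnegative terms, so the target entry
        -- at `i` has zero weight and nothing is lost by the missing inverse.
        · have h3 : ∀ τ ∈ Finset.univ,
              0 ≤ p τ * (∑ l, if e l = τ i then purifyFun d x l else 0) := fun τ _ =>
            mul_nonneg (hp τ) (Finset.sum_nonneg fun l _ => by
              split_ifs
              exacts [hPnn l, le_rfl])
          have h4 := (Finset.sum_eq_zero_iff_of_nonneg h3).mp ((hmix i).trans hi) σ
            (Finset.mem_univ _)
          have h5 : (∑ l, if e l = σ i then purifyFun d x l else 0) = purifyFun d x l := by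
            rw [← (hS σ l i).mp hl]
            simp [e.injective.eq_iff]
          rw [h5] at h4
          have h6 : Real.sqrt (p σ) * Real.sqrt (purifyFun d x l) = 0 := by
            rw [← Real.sqrt_mul (hp σ), h4, Real.sqrt_zero]
          have h7 : ((Real.sqrt (p σ) : ℝ) : ℂ) * ((Real.sqrt (purifyFun d x l) : ℝ) : ℂ) = 0 := by
            exact_mod_cast h6
          rw [mul_one, h7, hi]
          simp
        · have h8 : Real.sqrt (x i) ≠ 0 :=
            (Real.sqrt_pos.mpr (lt_of_le_of_ne (hx i) (Ne.symm hi))).ne'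
          have h9 : ((Real.sqrt (x i) : ℝ) : ℂ) ≠ 0 := by exact_mod_cast h8
          rw [Real.sqrt_inv]
          push_cast
          field_simp
      · simp only [if_neg hl]; simp
    · ext l j
      simp only [M, c, Sum.elim_inr]
      split_ifs with hi
      · simp only [sqrtDiag, Matrix.mul_diagonal, Matrix.single_apply]
        by_cases hj : i = j
        · subst hj; simp [hi]
        · simp [hj]
      · simp
  refine ⟨_, _, fun a => c ((Fintype.equivFin _).symm a), fun a => s ((Fintype.equivFin _).symm a),
    IsMeasurement.of_fintype hM, ?_, fun a => hMx _⟩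
  rw [← hc]
  exact (Fintype.equivFin (Equiv.Perm ι ⊕ ι)).symm.sum_comp fun a => c a ^ 2

section

open scoped ComplexOrder

/-! ### Determinants, traces and positive semidefinite matrices -/

theorem det_mul_eq_sum_submatrix {d : ℕ} {ι : Type} [Fintype ι] (M : Matrix (Fin d) ι ℂ)
    (N : Matrix ι (Fin d) ℂ) :
    (M * N).det = ∑ f : Fin d → ι, (∏ i, N (f i) i) * (M.submatrix id f).det := by
  classical
  simp only [Matrix.det_apply', Matrix.mul_apply, Finset.prod_univ_sum, Finset.mul_sum,
    Fintype.piFinset_univ, Matrix.submatrix_apply, id]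
  rw [Finset.sum_comm]
  refine Finset.sum_congr rfl fun f _ => Finset.sum_congr rfl fun σ _ => ?_
  rw [Finset.prod_mul_distrib]
  ring

/-- The Cauchy-Binet formula, as a sum over all functions. -/
theorem factorial_mul_det_mul {d : ℕ} {ι : Type} [Fintype ι] (M : Matrix (Fin d) ι ℂ)
    (N : Matrix ι (Fin d) ℂ) :
    (d.factorial : ℂ) * (M * N).det =
      ∑ f : Fin d → ι, (M.submatrix id f).det * (N.submatrix f id).det := by
  -- Permuting the chosen columns changes the minor of `M` by the sign of `σ`; summing over all `σ`
  -- assembles the Leibniz expansion of the minor of `N`, at the cost of the factor `d!`.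
  have h : ∀ σ : Equiv.Perm (Fin d), (M * N).det =
      ∑ f : Fin d → ι, (∏ i, N (f (σ i)) i) *
        (((Equiv.Perm.sign σ : ℤ) : ℂ) * (M.submatrix id f).det) := by
    intro σ
    rw [det_mul_eq_sum_submatrix, ← (Equiv.arrowCongr σ.symm (Equiv.refl ι)).sum_comp]
    refine Finset.sum_congr rfl fun f _ => ?_
    rw [← Matrix.det_permute' σ]
    rfl
  calc (d.factorial : ℂ) * (M * N).det = ∑ _σ : Equiv.Perm (Fin d), (M * N).det := by
        rw [Finset.sum_const, Finset.card_univ, Fintype.card_perm, Fintype.card_fin, nsmul_eq_mul]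
    _ = _ := by
        rw [Finset.sum_congr rfl fun σ _ => h σ, Finset.sum_comm]
        refine Finset.sum_congr rfl fun f _ => ?_
        rw [Matrix.det_apply' (N.submatrix f id), Finset.mul_sum]
        refine Finset.sum_congr rfl fun σ _ => ?_
        simp only [Matrix.submatrix_apply, id]
        ring

/-- By Cauchy-Binet, a diagonally weighted Gram determinant is a nonnegative combination of squared
minors, each multiplied by its own weights. Comparing such determinants thus reduces to comparing
products of `d` weights. -/
theorem factorial_mul_det_diagonal {d : ℕ} {ι : Type} [Fintype ι] [DecidableEq ι]
    (B : Matrix ι (Fin d) ℂ) (w : ι → ℝ) :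
    (d.factorial : ℝ) * (Bᴴ * Matrix.diagonal (fun i => (w i : ℂ)) * B).det.re =
      ∑ f : Fin d → ι, (∏ i, w (f i)) * ‖(B.submatrix f id).det‖ ^ 2 := by
  have h := factorial_mul_det_mul (Bᴴ * Matrix.diagonal (fun i => (w i : ℂ))) B
  have h2 : ∀ f : Fin d → ι,
      ((Bᴴ * Matrix.diagonal (fun i => (w i : ℂ))).submatrix id f).det * (B.submatrix f id).det =
      (((∏ i, w (f i)) * ‖(B.submatrix f id).det‖ ^ 2 : ℝ) : ℂ) := by
    intro f
    have h3 : (Bᴴ * Matrix.diagonal (fun i => (w i : ℂ))).submatrix id f =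
        (B.submatrix f id)ᴴ * Matrix.diagonal (fun i => (w (f i) : ℂ)) := by
      ext a b
      simp [Matrix.mul_diagonal]
    rw [h3, Matrix.det_mul, Matrix.det_diagonal, Matrix.det_conjTranspose]
    push_cast
    rw [← Complex.conj_mul', Complex.star_def]
    ring
  rw [Finset.sum_congr rfl fun f _ => h2 f, ← Complex.ofReal_sum] at h
  have h4 := congrArg Complex.re h
  rw [Complex.ofReal_re] at h4
  rw [← h4, ← Complex.ofReal_natCast, Complex.re_ofReal_mul]

theorem posSemidef_exists_diagonal {ι : Type} [Fintype ι] [DecidableEq ι] {N : Matrix ι ι ℂ}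
    (hN : N.PosSemidef) : ∃ (V : Matrix ι ι ℂ) (x : ι → ℝ), (∀ i, 0 ≤ x i) ∧ Vᴴ * V = 1 ∧
      V * Vᴴ = 1 ∧ N = V * Matrix.diagonal (fun i => (x i : ℂ)) * Vᴴ := by
  refine ⟨hN.1.eigenvectorUnitary, hN.1.eigenvalues, hN.eigenvalues_nonneg, ?_, ?_, ?_⟩
  · exact Unitary.coe_star_mul_self hN.1.eigenvectorUnitary
  · exact Unitary.coe_mul_star_self hN.1.eigenvectorUnitary
  · have := hN.1.spectral_theorem
    rw [Unitary.conjStarAlgAut_apply] at this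
    exact this

theorem posSemidef_exists_factor {ι : Type} [Fintype ι] [DecidableEq ι] {N : Matrix ι ι ℂ}
    (hN : N.PosSemidef) : ∃ Q : Matrix ι ι ℂ, N = Qᴴ * Q := by
  obtain ⟨V, x, hx, -, -, h⟩ := posSemidef_exists_diagonal hN
  refine ⟨sqrtDiag x * Vᴴ, ?_⟩
  rw [Matrix.conjTranspose_mul, Matrix.conjTranspose_conjTranspose, sqrtDiag_conjTranspose,
    Matrix.mul_assoc, ← Matrix.mul_assoc (sqrtDiag x), sqrtDiag_mul_sqrtDiag hx, h,
    Matrix.mul_assoc]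

theorem posSemidef_factor {ι κ : Type} [Fintype ι] [Fintype κ] (A : Matrix ι κ ℂ) :
    (Aᴴ * A).PosSemidef := by
  exact Matrix.posSemidef_conjTranspose_mul_self A

theorem posSemidef_factor' {ι κ : Type} [Fintype ι] [Fintype κ] (A : Matrix ι κ ℂ) :
    (A * Aᴴ).PosSemidef := by
  exact Matrix.posSemidef_self_mul_conjTranspose A

theorem posSemidef_trace_re_nonneg {ι : Type} [Fintype ι] {N : Matrix ι ι ℂ}
    (hN : N.PosSemidef) : 0 ≤ N.trace.re := by
  exact (Complex.le_def.mp hN.trace_nonneg).1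

theorem posSemidef_trace_im {ι : Type} [Fintype ι] {N : Matrix ι ι ℂ}
    (hN : N.PosSemidef) : N.trace.im = 0 := by
  exact (Complex.le_def.mp hN.trace_nonneg).2.symm

theorem posSemidef_det_re_nonneg {ι : Type} [Fintype ι] [DecidableEq ι] {N : Matrix ι ι ℂ}
    (hN : N.PosSemidef) : 0 ≤ N.det.re := by
  exact (Complex.le_def.mp hN.det_nonneg).1

theorem posSemidef_trace_mul_re_nonneg {ι : Type} [Fintype ι] {W H : Matrix ι ι ℂ}
    (hW : W.PosSemidef) (hH : H.PosSemidef) : 0 ≤ (W * H).trace.re := by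
  classical
  obtain ⟨K, rfl⟩ := posSemidef_exists_factor hH
  rw [← Matrix.mul_assoc, Matrix.trace_mul_comm, ← Matrix.mul_assoc]
  exact posSemidef_trace_re_nonneg (hW.mul_mul_conjTranspose_same K)

/-- The inequality between the arithmetic and the geometric mean of the eigenvalues. -/
theorem posSemidef_det_rpow_le_trace {d : ℕ} (hd : 0 < d) {C : Matrix (Fin d) (Fin d) ℂ}
    (hC : C.PosSemidef) : (d : ℝ) * C.det.re ^ (1 / (d : ℝ)) ≤ C.trace.re := by
  have hd' : (0 : ℝ) < d := by exact_mod_cast hd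
  have hev := hC.eigenvalues_nonneg
  have h1 : C.det.re = ∏ i, hC.1.eigenvalues i := by
    rw [hC.1.det_eq_prod_eigenvalues]
    simp only [RCLike.ofReal_eq_complex_ofReal] at *
    rw [← Complex.ofReal_prod, Complex.ofReal_re]
  have h2 : C.trace.re = ∑ i, hC.1.eigenvalues i := by
    rw [hC.1.trace_eq_sum_eigenvalues]
    simp
  have h3 := Real.geom_mean_le_arith_mean_weighted Finset.univ (fun _ : Fin d => 1 / (d : ℝ))
    hC.1.eigenvalues (fun _ _ => by positivity) (by simp [hd'.ne']) fun i _ => hev i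
  rw [Real.finsetProd_rpow _ _ fun i _ => hev i, ← Finset.mul_sum, ← h1, ← h2] at h3
  calc (d : ℝ) * C.det.re ^ (1 / (d : ℝ)) ≤ d * (1 / d * C.trace.re) := by gcongr
    _ = C.trace.re := by field_simp

/-! ### Admissible weights and the potential of a link -/

/-- A positive semidefinite weight that does not decrease any `d`-dimensional Gram determinant. -/
def Admissible (d : ℕ) {ι : Type} [Fintype ι] (W : Matrix ι ι ℂ) : Prop :=
  W.PosSemidef ∧ ∀ B : Matrix ι (Fin d) ℂ, (Bᴴ * B).det.re ≤ (Bᴴ * W * B).det.re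

theorem admissible_one (d : ℕ) {ι : Type} [Fintype ι] [DecidableEq ι] :
    Admissible d (1 : Matrix ι ι ℂ) :=
  ⟨Matrix.PosSemidef.one, fun B => by rw [Matrix.mul_one]⟩

theorem Admissible.conj {d : ℕ} {ι : Type} [Fintype ι] [DecidableEq ι] {W V : Matrix ι ι ℂ}
    (hW : Admissible d W) (hV : V * Vᴴ = 1) : Admissible d (V * W * Vᴴ) := by
  refine ⟨hW.1.mul_mul_conjTranspose_same V, fun B => ?_⟩
  have h := hW.2 (Vᴴ * B)
  have h1 : (Vᴴ * B)ᴴ * (Vᴴ * B) = Bᴴ * B := by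
    rw [Matrix.conjTranspose_mul, Matrix.conjTranspose_conjTranspose, Matrix.mul_assoc,
      ← Matrix.mul_assoc V, hV, Matrix.one_mul]
  have h2 : (Vᴴ * B)ᴴ * W * (Vᴴ * B) = Bᴴ * (V * W * Vᴴ) * B := by
    simp only [Matrix.conjTranspose_mul, Matrix.conjTranspose_conjTranspose, Matrix.mul_assoc]
  rwa [h1, h2] at h

/-- Compared minor by minor, each squared minor is multiplied by at least one; a minor with a
repeated row vanishes, so only distinct indices impose a condition. -/
theorem admissible_diagonal {d : ℕ} {ι : Type} [Fintype ι] [DecidableEq ι] {w : ι → ℝ}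
    (hw : ∀ i, 0 ≤ w i) (hprod : ∀ f : Fin d ↪ ι, 1 ≤ ∏ i, w (f i)) :
    Admissible d (Matrix.diagonal fun i => (w i : ℂ)) := by
  refine ⟨?_, fun B => ?_⟩
  · exact Matrix.PosSemidef.diagonal fun i => Complex.zero_le_real.mpr (hw i)
  · have h1 := factorial_mul_det_diagonal B w
    have h2 := factorial_mul_det_diagonal B fun _ => 1
    simp only [Complex.ofReal_one, Matrix.diagonal_one, Matrix.mul_one, Finset.prod_const_one,
      one_mul] at h2
    have hfac : (0 : ℝ) < d.factorial := by exact_mod_cast d.factorial_pos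
    refine le_of_mul_le_mul_left ?_ hfac
    rw [h1, h2]
    refine Finset.sum_le_sum fun f _ => ?_
    by_cases hf : Function.Injective f
    · exact le_mul_of_one_le_left (sq_nonneg _) (hprod ⟨f, hf⟩)
    · have h3 : (B.submatrix f id).det = 0 := by
        simp only [Function.Injective, not_forall] at hf
        obtain ⟨a, b, hab, hne⟩ := hf
        refine Matrix.det_zero_of_row_eq hne ?_
        funext j
        simp [Matrix.submatrix_apply, hab]
      rw [h3]
      simp

/-- In fewer than `d` dimensions all `d`-fold Gram determinants vanish and the condition on the
weight is void. The potential of links of too small a dimension is therefore zero. -/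
theorem admissible_zero {d : ℕ} {ι : Type} [Fintype ι] (hcard : Fintype.card ι < d) :
    Admissible d (0 : Matrix ι ι ℂ) := by
  classical
  have h : Admissible d (Matrix.diagonal fun _ : ι => ((0 : ℝ) : ℂ)) :=
    admissible_diagonal (fun _ => le_rfl) fun f => by
      have := Fintype.card_le_of_embedding f
      rw [Fintype.card_fin] at this
      omega
  simpa using h

/-- The least weighted trace over all admissible weights. -/
def potential (d : ℕ) {ι : Type} [Fintype ι] (H : Matrix ι ι ℂ) : ℝ :=
  sInf {r | ∃ W : Matrix ι ι ℂ, Admissible d W ∧ (W * H).trace.re = r}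

theorem potential_le {d : ℕ} {ι : Type} [Fintype ι] {W H : Matrix ι ι ℂ}
    (hW : Admissible d W) (hH : H.PosSemidef) : potential d H ≤ (W * H).trace.re := by
  refine csInf_le ⟨0, ?_⟩ ⟨W, hW, rfl⟩
  rintro r ⟨W', hW', rfl⟩
  exact posSemidef_trace_mul_re_nonneg hW'.1 hH

theorem le_potential {d : ℕ} {ι : Type} [Fintype ι] {H : Matrix ι ι ℂ} {c : ℝ}
    (h : ∀ W, Admissible d W → c ≤ (W * H).trace.re) : c ≤ potential d H := by
  classical
  refine le_csInf ⟨_, 1, admissible_one d, rfl⟩ ?_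
  rintro r ⟨W, hW, rfl⟩
  exact h W hW

theorem potential_nonneg {d : ℕ} {ι : Type} [Fintype ι] {H : Matrix ι ι ℂ}
    (hH : H.PosSemidef) : 0 ≤ potential d H :=
  le_potential fun _ hW => posSemidef_trace_mul_re_nonneg hW.1 hH

/-- Allows the infimum to be taken in one factor of a product; if `b = 0`, any single admissible
weight already gives `c ≤ 0`. -/
theorem le_potential_mul {d : ℕ} {ι : Type} [Fintype ι] {H : Matrix ι ι ℂ} {b c : ℝ}
    (hb : 0 ≤ b)
    (h : ∀ W, Admissible d W → c ≤ (W * H).trace.re * b) : c ≤ potential d H * b := by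
  classical
  rcases hb.eq_or_lt with rfl | hb
  · simpa using h 1 (admissible_one d)
  · rw [← div_le_iff₀ hb]
    exact le_potential fun W hW => (div_le_iff₀ hb).mpr (h W hW)

/-- The `G`-concurrence of the state that results from deterministic purification. -/
def purifiedG {ι : Type} [Fintype ι] (d : ℕ) (x : ι → ℝ) : ℝ :=
  (d : ℝ) * (∏ l, purifyFun d x l) ^ (1 / (d : ℝ))

theorem trace_diagonal_mul_diagonal {ι : Type} [Fintype ι] [DecidableEq ι] (w x : ι → ℝ) :
    ((Matrix.diagonal fun i => (w i : ℂ)) * Matrix.diagonal fun i => (x i : ℂ)).trace.re =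
      ∑ i, w i * x i := by
  rw [Matrix.diagonal_mul_diagonal, Matrix.trace_diagonal, ← Complex.ofReal_re (∑ i, w i * x i)]
  push_cast
  rfl

/-- Near-optimal diagonal weights for a diagonal state. -/
theorem exists_admissible_diagonal {ι : Type} [Fintype ι] [DecidableEq ι] {d : ℕ} (hd : 0 < d)
    (hcard : d ≤ Fintype.card ι) {x : ι → ℝ} (hx : ∀ i, 0 ≤ x i) {ε : ℝ} (hε : 0 < ε) :
    ∃ w : ι → ℝ, Admissible d (Matrix.diagonal fun i => (w i : ℂ)) ∧
      ∑ i, w i * x i ≤ purifiedG d x + ε := by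
  have hd' : (0 : ℝ) < d := by exact_mod_cast hd
  have hPnn := (purifyFun_antitone_nonneg hd hcard hx).2
  obtain ⟨e, J, t, hJ, ht, h1, h2, h3, h4⟩ := purifyFun_structure hd hcard hx
  set T := J.map e with hT
  have hcT : T.card = J.card := Finset.card_map _
  have hcJ : J.card + Jᶜ.card = d := by
    rw [Finset.card_add_card_compl, Fintype.card_fin]
  rcases ht.eq_or_lt with ht0 | htpos
  · have hS : 0 ≤ ∑ i, x i := Finset.sum_nonneg fun i _ => hx i
    -- Here `x` lives on `T`, which has fewer than `d` elements. A tiny weight on `T` is compensated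
    -- by a huge weight off `T`, where it costs nothing, and every `d` distinct indices include one
    -- of the latter. The infimum need not be attained, whence the `ε`.
    set δ := min 1 (ε / (∑ i, x i + 1)) with hδ
    have hδ0 : 0 < δ := lt_min one_pos (by positivity)
    have hδ1 : δ ≤ 1 := min_le_left _ _
    have hw0 : ∀ i, δ ≤ (if i ∈ T then δ else (δ ^ (d - 1))⁻¹) := by
      intro i
      split_ifs
      · exact le_rfl
      · exact hδ1.trans ((one_le_inv₀ (by positivity)).mpr (pow_le_one₀ hδ0.le hδ1))
    refine ⟨fun i => if i ∈ T then δ else (δ ^ (d - 1))⁻¹,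
      admissible_diagonal (fun i => hδ0.le.trans (hw0 i)) fun f => ?_, ?_⟩
    · have hex : ∃ k, f k ∉ T := by
        by_contra hall
        push Not at hall
        have h5 : Finset.univ.map f ⊆ T := fun i hi => by
          obtain ⟨k, -, rfl⟩ := Finset.mem_map.mp hi
          exact hall k
        have h6 := Finset.card_le_card h5
        rw [Finset.card_map, Finset.card_univ, Fintype.card_fin, hcT] at h6
        have := hJ.card_pos
        omega
      obtain ⟨k, hk⟩ := hex
      rw [← Finset.mul_prod_erase Finset.univ _ (Finset.mem_univ k), if_neg hk]
      have h7 : δ ^ (d - 1) ≤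
          ∏ i ∈ Finset.univ.erase k, (if f i ∈ T then δ else (δ ^ (d - 1))⁻¹) := by
        calc δ ^ (d - 1) = ∏ i ∈ Finset.univ.erase k, δ := by
              rw [Finset.prod_const, Finset.card_erase_of_mem (Finset.mem_univ k),
                Finset.card_univ, Fintype.card_fin]
          _ ≤ _ := Finset.prod_le_prod (fun _ _ => hδ0.le) fun i _ => hw0 (f i)
      calc (1 : ℝ) = (δ ^ (d - 1))⁻¹ * δ ^ (d - 1) := (inv_mul_cancel₀ (by positivity)).symm
        _ ≤ _ := mul_le_mul_of_nonneg_left h7 (by positivity)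
    · have h5 : ∑ i, (if i ∈ T then δ else (δ ^ (d - 1))⁻¹) * x i ≤ ∑ i, δ * x i := by
        refine Finset.sum_le_sum fun i _ => ?_
        split_ifs with hi
        · exact le_rfl
        · rw [le_antisymm ((h3 i hi).trans ht0.ge) (hx i)]
          simp
      refine h5.trans ?_
      rw [← Finset.mul_sum]
      have h6 : δ * ∑ i, x i ≤ ε := by
        calc δ * ∑ i, x i ≤ ε / (∑ i, x i + 1) * (∑ i, x i + 1) := by
              gcongr
              · exact min_le_right _ _
              · linarith
          _ = ε := by field_simp
      have h7 : 0 ≤ purifiedG d x :=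
        mul_nonneg hd'.le (Real.rpow_nonneg (Finset.prod_nonneg fun l _ => hPnn l) _)
      linarith
  · have hxT : ∀ i ∈ T, t ≤ x i := by
      intro i hi
      obtain ⟨l, hl, rfl⟩ := Finset.mem_map.mp hi
      exact (h1 l hl).2
    set pr := ∏ l, purifyFun d x l with hpr
    have hpreq : pr = (∏ l ∈ J, x (e l)) * t ^ Jᶜ.card := by
      rw [hpr, ← Finset.prod_mul_prod_compl J, Finset.prod_congr rfl fun l hl => (h1 l hl).1,
        Finset.prod_congr rfl fun l hl => h2 l (Finset.mem_compl.mp hl), Finset.prod_const]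
    have hprpos : 0 < pr := by
      rw [hpreq]
      exact mul_pos (Finset.prod_pos fun l hl => htpos.trans_le (h1 l hl).2) (by positivity)
    -- With `c` the geometric mean of the purified entries, the weight is `c / x i` on `T` and `c /
    -- t` elsewhere. Each copied entry then costs `c` and the rest together `Jᶜ.card * c`, for a
    -- total of `d * c`.
    set c := pr ^ (1 / (d : ℝ)) with hc
    have hcpos : 0 < c := Real.rpow_pos_of_pos hprpos _
    have hcd : c ^ d = pr := by
      rw [hc, ← Real.rpow_natCast, ← Real.rpow_mul hprpos.le, one_div, inv_mul_cancel₀ hd'.ne',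
        Real.rpow_one]
    let v : ι → ℝ := fun i => if i ∈ T then t / x i else 1
    have hv0 : ∀ i, 0 ≤ v i := fun i => by
      simp only [v]
      split_ifs
      · exact div_nonneg htpos.le (hx i)
      · exact zero_le_one
    have hv1 : ∀ i, v i ≤ 1 := fun i => by
      simp only [v]
      split_ifs with hi
      · exact (div_le_one (htpos.trans_le (hxT i hi))).mpr (hxT i hi)
      · exact le_rfl
    refine ⟨fun i => c / t * v i,
      admissible_diagonal (fun i => mul_nonneg (by positivity) (hv0 i)) fun f => ?_, ?_⟩
    · rw [Finset.prod_mul_distrib, Finset.prod_const, Finset.card_univ, Fintype.card_fin]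
      -- Since `v ≤ 1`, with equality off `T`, the smallest product over `d` distinct indices occurs
      -- when all of `T` is used; that product is normalized to one by the choice of `c`.
      have h5 : ∏ i ∈ T, v i ≤ ∏ k, v (f k) := by
        rw [← Finset.prod_map Finset.univ f v, ← Finset.prod_inter_mul_prod_sdiff T (Finset.univ.map f)]
        have h6 : ∏ i ∈ Finset.univ.map f, v i = ∏ i ∈ T ∩ Finset.univ.map f, v i := by
          symm
          refine Finset.prod_subset Finset.inter_subset_right fun i hi hi' => ?_
          have : i ∉ T := fun hT' => hi' (Finset.mem_inter.mpr ⟨hT', hi⟩)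
          simp [v, this]
        rw [h6]
        exact mul_le_of_le_one_right (Finset.prod_nonneg fun i _ => hv0 i)
          (Finset.prod_le_one (fun i _ => hv0 i) fun i _ => hv1 i)
      have h7 : (c / t) ^ d * ∏ i ∈ T, v i = 1 := by
        have h8 : ∏ i ∈ T, v i = ∏ l ∈ J, t / x (e l) := by
          rw [hT, Finset.prod_map]
          refine Finset.prod_congr rfl fun l hl => ?_
          have : e l ∈ T := Finset.mem_map_of_mem e hl
          simp only [v, if_pos this]
        have h9 : ∏ l ∈ J, x (e l) ≠ 0 :=
          (Finset.prod_pos fun l hl => htpos.trans_le (h1 l hl).2).ne'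
        rw [h8, div_pow, hcd, hpreq, Finset.prod_div_distrib, Finset.prod_const]
        have h10 : t ^ d = t ^ J.card * t ^ Jᶜ.card := by rw [← pow_add, hcJ]
        rw [h10]
        field_simp
      calc (1 : ℝ) = (c / t) ^ d * ∏ i ∈ T, v i := h7.symm
        _ ≤ _ := mul_le_mul_of_nonneg_left h5 (by positivity)
    · have h5 : ∑ i, c / t * v i * x i = d * c := by
        rw [← Finset.sum_add_sum_compl T]
        have h6 : ∑ i ∈ T, c / t * v i * x i = ∑ i ∈ T, c := by
          refine Finset.sum_congr rfl fun i hi => ?_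
          have : 0 < x i := htpos.trans_le (hxT i hi)
          simp only [v, if_pos hi]
          field_simp
        have h7 : ∑ i ∈ Tᶜ, c / t * v i * x i = ∑ i ∈ Tᶜ, c / t * x i := by
          refine Finset.sum_congr rfl fun i hi => ?_
          simp only [v, if_neg (Finset.mem_compl.mp hi), mul_one]
        rw [h6, h7, ← Finset.mul_sum, h4, Finset.sum_const, nsmul_eq_mul, hcT]
        have h8 : (d : ℝ) = J.card + Jᶜ.card := by exact_mod_cast hcJ.symm
        rw [h8]
        field_simp
      rw [h5]
      change d * c ≤ d * c + ε
      linarith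

/-! ### Duality for the potential and its symmetry between the two ends -/

theorem potential_diagonal_le {ι : Type} [Fintype ι] [DecidableEq ι] {d : ℕ} (hd : 0 < d)
    (hcard : d ≤ Fintype.card ι) {x : ι → ℝ} (hx : ∀ i, 0 ≤ x i) {V : Matrix ι ι ℂ}
    (hV : Vᴴ * V = 1) :
    potential d (V * Matrix.diagonal (fun i => (x i : ℂ)) * Vᴴ) ≤ purifiedG d x := by
  refine le_of_forall_pos_le_add fun ε hε => ?_
  obtain ⟨w, hw, hle⟩ := exists_admissible_diagonal hd hcard hx hε
  refine le_trans (potential_le (hw.conj (mul_eq_one_comm.mp hV)) ?_) (le_trans (le_of_eq ?_) hle)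
  · refine Matrix.PosSemidef.mul_mul_conjTranspose_same ?_ V
    exact Matrix.PosSemidef.diagonal fun i => Complex.zero_le_real.mpr (hx i)
  · rw [← trace_diagonal_mul_diagonal, Matrix.mul_assoc, Matrix.mul_assoc V, Matrix.trace_mul_comm]
    congr 1
    congr 1
    simp only [Matrix.mul_assoc]
    rw [← Matrix.mul_assoc Vᴴ V, hV, Matrix.one_mul, Matrix.mul_one]

/-- Weak duality. For any admissible `W`, each determinant only grows when `W` is inserted, and its
root is then bounded by a trace; the traces add up to `tr (W K K†)` by completeness of the `L a`. -/
theorem roof_le_potential {ι κ τ : Type} [Fintype ι] [Fintype κ] [DecidableEq κ] [Fintype τ]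
    {d : ℕ} (hd : 0 < d) (K : Matrix ι κ ℂ) {L : τ → Matrix κ (Fin d) ℂ}
    (hL : ∑ a, L a * (L a)ᴴ = 1) :
    ∑ a, (d : ℝ) * ((L a)ᴴ * (Kᴴ * K) * L a).det.re ^ (1 / (d : ℝ)) ≤ potential d (K * Kᴴ) := by
  refine le_potential fun W hW => ?_
  have h1 : ∀ a, (d : ℝ) * ((L a)ᴴ * (Kᴴ * K) * L a).det.re ^ (1 / (d : ℝ)) ≤
      ((L a)ᴴ * (Kᴴ * W * K) * L a).trace.re := by
    intro a
    have h2 : (L a)ᴴ * (Kᴴ * K) * L a = (K * L a)ᴴ * (K * L a) := by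
      simp only [Matrix.conjTranspose_mul, Matrix.mul_assoc]
    have h3 : (L a)ᴴ * (Kᴴ * W * K) * L a = (K * L a)ᴴ * W * (K * L a) := by
      simp only [Matrix.conjTranspose_mul, Matrix.mul_assoc]
    rw [h2, h3]
    refine le_trans ?_ (posSemidef_det_rpow_le_trace hd (hW.1.conjTranspose_mul_mul_same _))
    have := posSemidef_det_re_nonneg (posSemidef_factor (K * L a))
    exact mul_le_mul_of_nonneg_left (Real.rpow_le_rpow this (hW.2 _) (by positivity))
      (Nat.cast_nonneg d)
  refine (Finset.sum_le_sum fun a _ => h1 a).trans (le_of_eq ?_)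
  rw [← Complex.re_sum, ← Matrix.trace_sum]
  have h4 : ∀ a, ((L a)ᴴ * (Kᴴ * W * K) * L a).trace =
      (Kᴴ * W * K * (L a * (L a)ᴴ)).trace := by
    intro a
    rw [Matrix.mul_assoc, Matrix.trace_mul_comm, Matrix.mul_assoc]
  rw [Matrix.trace_sum, Finset.sum_congr rfl fun a _ => h4 a, ← Matrix.trace_sum,
    ← Matrix.mul_sum, hL, Matrix.mul_one, Matrix.mul_assoc, Matrix.trace_mul_comm,
    Matrix.mul_assoc]

/-- A purification measurement attains the `G`-concurrence of deterministic purification. -/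
theorem exists_roof_eq {ι : Type} [Fintype ι] [DecidableEq ι] {d : ℕ} (hd : 0 < d)
    (hcard : d ≤ Fintype.card ι) {x : ι → ℝ} (hx : ∀ i, 0 ≤ x i) {V : Matrix ι ι ℂ}
    (hV : Vᴴ * V = 1) :
    ∃ (k : ℕ) (L : Fin k → Matrix ι (Fin d) ℂ), ∑ a, L a * (L a)ᴴ = 1 ∧
      ∑ a, (d : ℝ) * ((L a)ᴴ * (V * Matrix.diagonal (fun i => (x i : ℂ)) * Vᴴ) * L a).det.re ^
        (1 / (d : ℝ)) = purifiedG d x := by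
  have hd' : (0 : ℝ) < d := by exact_mod_cast hd
  have hPnn := (purifyFun_antitone_nonneg hd hcard hx).2
  obtain ⟨k, M, c, s, hM, hc, h⟩ := exists_purification_measurement hd hcard hx
  -- The purification measurement is carried to the eigenbasis. Each outcome has Gram matrix `c a ^
  -- 2` times `diag(P(x))`, so its term is `c a ^ 2 * purifiedG d x`, and the squares of the `c a`
  -- sum to one.
  refine ⟨k, fun a => V * (M a)ᴴ, ?_, ?_⟩
  · simp only [Matrix.conjTranspose_mul, Matrix.conjTranspose_conjTranspose]
    have h1 : ∀ a, V * (M a)ᴴ * (M a * Vᴴ) = V * ((M a)ᴴ * M a) * Vᴴ := fun a => by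
      simp only [Matrix.mul_assoc]
    rw [Finset.sum_congr rfl fun a _ => h1 a, ← Matrix.sum_mul, ← Matrix.mul_sum]
    rw [show ∑ a, (M a)ᴴ * M a = 1 from hM, Matrix.mul_one]
    exact mul_eq_one_comm.mp hV
  · have h1 : ∀ a, (V * (M a)ᴴ)ᴴ * (V * Matrix.diagonal (fun i => (x i : ℂ)) * Vᴴ) *
        (V * (M a)ᴴ) =
        Matrix.diagonal fun l => ((c a ^ 2 * purifyFun d x l : ℝ) : ℂ) := by
      intro a
      have h2 : (V * (M a)ᴴ)ᴴ * (V * Matrix.diagonal (fun i => (x i : ℂ)) * Vᴴ) *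
          (V * (M a)ᴴ) = M a * ((Vᴴ * V) * Matrix.diagonal (fun i => (x i : ℂ)) * (Vᴴ * V)) *
          (M a)ᴴ := by
        simp only [Matrix.conjTranspose_mul, Matrix.conjTranspose_conjTranspose, Matrix.mul_assoc]
      have h3 : M a * (sqrtDiag x * sqrtDiag x) * (M a)ᴴ =
          (M a * sqrtDiag x) * (M a * sqrtDiag x)ᴴ := by
        simp only [Matrix.conjTranspose_mul, sqrtDiag_conjTranspose, Matrix.mul_assoc]
      rw [h2, hV, Matrix.one_mul, Matrix.mul_one, ← sqrtDiag_mul_sqrtDiag hx, h3, h a]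
      rw [Matrix.conjTranspose_smul, Matrix.conjTranspose_mul, sqrtDiag_conjTranspose,
        Matrix.smul_mul, Matrix.mul_smul, Matrix.mul_assoc (sqrtDiag _),
        ← Matrix.mul_assoc (selection _), selection_mul_conjTranspose, Matrix.one_mul,
        sqrtDiag_mul_sqrtDiag hPnn, smul_smul, ← Matrix.diagonal_smul]
      congr 1
      funext l
      simp only [Pi.smul_apply, smul_eq_mul, Complex.star_def, Complex.conj_ofReal]
      push_cast
      ring
    have h4 : ∀ a, (d : ℝ) * ((V * (M a)ᴴ)ᴴ * (V * Matrix.diagonal (fun i => (x i : ℂ)) * Vᴴ) *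
        (V * (M a)ᴴ)).det.re ^ (1 / (d : ℝ)) = c a ^ 2 * purifiedG d x := by
      intro a
      rw [h1, Matrix.det_diagonal, ← Complex.ofReal_prod, Complex.ofReal_re,
        Finset.prod_mul_distrib, Finset.prod_const, Finset.card_univ, Fintype.card_fin,
        Real.mul_rpow (by positivity) (Finset.prod_nonneg fun l _ => hPnn l), ← Real.rpow_natCast,
        ← Real.rpow_mul (sq_nonneg _), mul_one_div_cancel hd'.ne', Real.rpow_one, purifiedG]
      ring
    rw [Finset.sum_congr rfl fun a _ => h4 a, ← Finset.sum_mul, hc, one_mul]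

/-- Strong duality for the spectrum of `A†A` expresses an upper bound of its potential as a sum of
determinant roots. Admissibility of `W = Q†Q` allows `A` to be replaced by `Q * A` in each
determinant, and weak duality passes to the other end. If the right dimension is below `d`, the left
side is at most zero. -/
theorem potential_gram_le {ι κ : Type} [Fintype ι] [Fintype κ] {d : ℕ} (hd : 0 < d)
    (A : Matrix ι κ ℂ) {W : Matrix ι ι ℂ} (hW : Admissible d W) :
    ∃ Q : Matrix ι ι ℂ, W = Qᴴ * Q ∧
      potential d (Aᴴ * A) ≤ potential d ((Q * A) * (Q * A)ᴴ) := by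
  classical
  obtain ⟨Q, hQ⟩ := posSemidef_exists_factor hW.1
  refine ⟨Q, hQ, ?_⟩
  rcases lt_or_ge (Fintype.card κ) d with hlt | hcard
  · refine (potential_le (admissible_zero hlt) (posSemidef_factor A)).trans ?_
    simpa using potential_nonneg (posSemidef_factor' (Q * A))
  · obtain ⟨V, x, hx, hV, -, hN⟩ := posSemidef_exists_diagonal (posSemidef_factor A)
    obtain ⟨k, L, hL, hsum⟩ := exists_roof_eq hd hcard hx hV
    rw [← hN] at hsum
    have h1 : potential d (Aᴴ * A) ≤ purifiedG d x := by
      rw [hN]; exact potential_diagonal_le hd hcard hx hV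
    refine h1.trans (hsum.symm.le.trans ((Finset.sum_le_sum fun a _ => ?_).trans
      (roof_le_potential hd (Q * A) hL)))
    have h2 : (L a)ᴴ * (Aᴴ * A) * L a = (A * L a)ᴴ * (A * L a) := by
      simp only [Matrix.conjTranspose_mul, Matrix.mul_assoc]
    have h3 : (L a)ᴴ * ((Q * A)ᴴ * (Q * A)) * L a = (A * L a)ᴴ * W * (A * L a) := by
      rw [hQ]
      simp only [Matrix.conjTranspose_mul, Matrix.mul_assoc]
    rw [h2, h3]
    have := posSemidef_det_re_nonneg (posSemidef_factor (A * L a))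
    exact mul_le_mul_of_nonneg_left (Real.rpow_le_rpow this (hW.2 _) (by positivity))
      (Nat.cast_nonneg d)

/-- The previous inequality for `W = 1`, applied to `A` and to its adjoint. The factor `Q` obtained
there is only known to be unitary and is absorbed into the weights by conjugation. -/
theorem potential_gram_comm {ι κ : Type} [Fintype ι] [Fintype κ] {d : ℕ} (hd : 0 < d)
    (A : Matrix ι κ ℂ) : potential d (Aᴴ * A) = potential d (A * Aᴴ) := by
  have h : ∀ {ι κ : Type} [Fintype ι] [Fintype κ] (A : Matrix ι κ ℂ),
      potential d (Aᴴ * A) ≤ potential d (A * Aᴴ) := by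
    intro ι κ _ _ A
    classical
    obtain ⟨Q, hQ, h⟩ := potential_gram_le hd A (admissible_one d)
    refine le_potential fun W hW => h.trans ?_
    have hQ' : Q * Qᴴ = 1 := mul_eq_one_comm.mp hQ.symm
    refine (potential_le (hW.conj hQ') (posSemidef_factor' (Q * A))).trans (le_of_eq ?_)
    have h1 : Q * W * Qᴴ * (Q * A * (Q * A)ᴴ) = Q * (W * (Qᴴ * Q) * A * Aᴴ * Qᴴ) := by
      simp only [Matrix.conjTranspose_mul, Matrix.mul_assoc]
    rw [h1, ← hQ, Matrix.trace_mul_comm, Matrix.mul_one, Matrix.mul_assoc, ← hQ, Matrix.mul_one,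
      Matrix.mul_assoc]
  refine le_antisymm (h A) ?_
  have := h Aᴴ
  rwa [Matrix.conjTranspose_conjTranspose] at this

/-- Weights on both sides bound the potential. -/
theorem potential_le_two_sided {ι κ : Type} [Fintype ι] [Fintype κ] {d : ℕ} (hd : 0 < d)
    (A : Matrix ι κ ℂ) {W : Matrix ι ι ℂ} {W' : Matrix κ κ ℂ} (hW : Admissible d W)
    (hW' : Admissible d W') :
    potential d (A * Aᴴ) ≤ (W' * (Aᴴ * W * A)).trace.re := by
  obtain ⟨Q, hQ, h⟩ := potential_gram_le hd A hW
  rw [← potential_gram_comm hd]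
  refine h.trans ?_
  rw [← potential_gram_comm hd]
  refine (potential_le hW' (posSemidef_factor _)).trans (le_of_eq ?_)
  rw [hQ]
  simp only [Matrix.conjTranspose_mul, Matrix.mul_assoc]

end

/-! ### Squared singular values -/

theorem desc_const_mul {d : ℕ} {r : ℝ} (hr : 0 ≤ r) (y : Fin d → ℝ) (l : Fin d) :
    desc (fun i => r * y i) l = r * desc y l := by
  obtain ⟨σ, hσ⟩ := exists_perm_desc y
  have hanti : Antitone (y ∘ σ) := by
    intro a b hab
    obtain ⟨e, he, hd⟩ := exists_sorting_equiv y
    have hcard := Fintype.card_fin d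
    simp only [Function.comp_apply]
    rw [← hσ, ← hσ, hd, hd, dif_pos (by rw [hcard]; exact b.2), dif_pos (by rw [hcard]; exact a.2)]
    exact he hab
  have h1 : desc (fun i => r * y i) = desc ((fun i => r * y i) ∘ σ) :=
    (desc_comp_equiv _ σ).symm
  rw [h1, hσ]
  exact desc_eq_self (y := (fun i => r * y i) ∘ σ)
    (fun a b hab => mul_le_mul_of_nonneg_left (hanti hab) hr) l

theorem prod_desc {d : ℕ} (y : Fin d → ℝ) : ∏ l : Fin d, desc y l = ∏ l, y l := by
  obtain ⟨σ, hσ⟩ := exists_perm_desc y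
  rw [Finset.prod_congr rfl fun l _ => hσ l]
  exact Equiv.prod_comp σ y

theorem sqSingular_antitone {d : ℕ} (A : Matrix (Fin d) (Fin d) ℂ) : Antitone (sqSingular A) := by
  intro a b hab
  unfold sqSingular
  have h1 := (Matrix.toEuclideanLin A).singularValues_antitone (show (a : ℕ) ≤ b from hab)
  have h2 := (Matrix.toEuclideanLin A).singularValues_nonneg b
  gcongr

theorem sqSingular_nonneg {d : ℕ} (A : Matrix (Fin d) (Fin d) ℂ) (i : Fin d) :
    0 ≤ sqSingular A i := sq_nonneg _

/-- The squared singular values are the eigenvalues of `A†A`, hence determined by its characteristic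
polynomial. They can thus be read off from any unitary diagonalization. -/
theorem ofFn_sqSingular {d : ℕ} (A : Matrix (Fin d) (Fin d) ℂ) :
    List.ofFn (sqSingular A) = ((Aᴴ * A).charpoly.roots.map Complex.re).sort (· ≥ ·) := by
  have hn : Module.finrank ℂ (EuclideanSpace ℂ (Fin d)) = d := by simp
  have h1 : sqSingular A =
      (Matrix.toEuclideanLin A).isSymmetric_adjoint_comp_self.eigenvalues hn := by
    funext i
    exact (Matrix.toEuclideanLin A).sq_singularValues_fin hn i
  rw [h1, ← LinearMap.IsSymmetric.sort_roots_charpoly_eq_eigenvalues]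
  have h2 : (LinearMap.adjoint (Matrix.toEuclideanLin A) ∘ₗ Matrix.toEuclideanLin A) =
      Matrix.toEuclideanLin (Aᴴ * A) := by
    rw [← Matrix.toEuclideanLin_conjTranspose_eq_adjoint]
    exact (Matrix.toLpLin_mul _ _ _ _ _).symm
  have h3 : (Matrix.toEuclideanLin (Aᴴ * A)).charpoly = (Aᴴ * A).charpoly := by
    rw [show Matrix.toEuclideanLin (Aᴴ * A) = Matrix.toLpLin 2 2 (Aᴴ * A) from rfl,
      Matrix.toLpLin_eq_toLin, Matrix.charpoly_toLin]
  rw [h2, h3]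
  rfl

theorem sqSingular_eq_desc {d : ℕ} {A V : Matrix (Fin d) (Fin d) ℂ} {y : Fin d → ℝ}
    (hV : Vᴴ * V = 1) (h : Aᴴ * A = V * Matrix.diagonal (fun i => (y i : ℂ)) * Vᴴ) (i : Fin d) :
    sqSingular A i = desc y i := by
  have h1 : (Aᴴ * A).charpoly.roots.map Complex.re = Finset.univ.val.map y := by
    rw [h, Matrix.charpoly_mul_comm, ← Matrix.mul_assoc, hV, Matrix.one_mul,
      Matrix.charpoly_diagonal, Polynomial.roots_prod _ _ (by
        simp [Finset.prod_ne_zero_iff, Polynomial.X_sub_C_ne_zero])]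
    simp only [Polynomial.roots_X_sub_C, Multiset.bind_singleton, Multiset.map_map]
    exact Multiset.map_congr rfl fun i _ => Complex.ofReal_re _
  have h2 := ofFn_sqSingular A
  rw [h1] at h2
  unfold desc
  rw [← h2]
  simp

theorem exists_gram_diagonal {d : ℕ} (A : Matrix (Fin d) (Fin d) ℂ) :
    ∃ V : Matrix (Fin d) (Fin d) ℂ, Vᴴ * V = 1 ∧
      Aᴴ * A = V * Matrix.diagonal (fun i => (sqSingular A i : ℂ)) * Vᴴ := by
  obtain ⟨V, y, -, hV, -, h⟩ := posSemidef_exists_diagonal (posSemidef_factor A)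
  obtain ⟨σ, hσ⟩ := exists_perm_desc y
  refine ⟨V.submatrix id σ, ?_, ?_⟩
  · have h1 : (V.submatrix id σ)ᴴ * V.submatrix id σ = (Vᴴ * V).submatrix σ σ := by
      ext a b
      simp [Matrix.mul_apply]
    rw [h1, hV]
    ext a b
    simp [Matrix.one_apply]
  · have h2 : ∀ i, sqSingular A i = y (σ i) := fun i => (sqSingular_eq_desc hV h i).trans (hσ i)
    rw [h]
    ext a b
    rw [Matrix.mul_apply, Matrix.mul_apply, ← Equiv.sum_comp σ]
    simp [Matrix.mul_diagonal, h2]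

theorem sqSingular_smul {d : ℕ} (r : ℝ) (A : Matrix (Fin d) (Fin d) ℂ) (i : Fin d) :
    sqSingular ((r : ℂ) • A) i = r ^ 2 * sqSingular A i := by
  obtain ⟨V, hV, h⟩ := exists_gram_diagonal A
  have h1 : ((r : ℂ) • A)ᴴ * ((r : ℂ) • A) =
      V * Matrix.diagonal (fun i => ((r ^ 2 * sqSingular A i : ℝ) : ℂ)) * Vᴴ := by
    have h2 : (Matrix.diagonal fun i => ((r ^ 2 * sqSingular A i : ℝ) : ℂ)) =
        ((r : ℂ) ^ 2) • Matrix.diagonal fun i => (sqSingular A i : ℂ) := by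
      rw [← Matrix.diagonal_smul]
      congr 1
      funext i
      simp
    have h3 : V * (((r : ℂ) ^ 2) • Matrix.diagonal fun i => (sqSingular A i : ℂ)) * Vᴴ =
        ((r : ℂ) ^ 2) • (Aᴴ * A) := by
      rw [h, Matrix.mul_smul, Matrix.smul_mul]
    rw [h2, h3, Matrix.conjTranspose_smul, Matrix.smul_mul, Matrix.mul_smul, smul_smul,
      Complex.star_def, Complex.conj_ofReal, sq]
  rw [sqSingular_eq_desc hV h1, desc_const_mul (sq_nonneg r), desc_eq_self (sqSingular_antitone A)]

theorem prod_sqSingular {d : ℕ} (A : Matrix (Fin d) (Fin d) ℂ) :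
    ∏ i, sqSingular A i = ‖A.det‖ ^ 2 := by
  obtain ⟨V, hV, h⟩ := exists_gram_diagonal A
  have h1 := congrArg Matrix.det h
  rw [Matrix.det_mul, Matrix.det_mul_right_comm, mul_eq_one_comm.mp hV, Matrix.one_mul,
    Matrix.det_diagonal, Matrix.det_conjTranspose, Complex.star_def, Complex.conj_mul',
    ← Complex.ofReal_prod] at h1
  exact_mod_cast h1.symm

/-! ### Probabilities and Schmidt vectors of outcomes -/

theorem prob_eq_trace {d : ℕ} (A : Matrix (Fin d) (Fin d) ℂ) : prob A = (Aᴴ * A).trace.re := by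
  unfold prob
  rw [Matrix.trace, Complex.re_sum, Finset.sum_comm]
  refine Finset.sum_congr rfl fun j _ => ?_
  rw [Matrix.diag_apply, Matrix.mul_apply, Complex.re_sum]
  refine Finset.sum_congr rfl fun i _ => ?_
  rw [Matrix.conjTranspose_apply, Complex.star_def, Complex.conj_mul']
  norm_cast

theorem prob_nonneg {d : ℕ} (A : Matrix (Fin d) (Fin d) ℂ) : 0 ≤ prob A := by
  unfold prob
  positivity

theorem prob_eq_sum {d : ℕ} {A V : Matrix (Fin d) (Fin d) ℂ} {y : Fin d → ℝ}
    (hV : Vᴴ * V = 1) (h : Aᴴ * A = V * Matrix.diagonal (fun i => (y i : ℂ)) * Vᴴ) :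
    prob A = ∑ i, y i := by
  rw [prob_eq_trace, h, Matrix.trace_mul_comm, ← Matrix.mul_assoc, hV, Matrix.one_mul,
    Matrix.trace_diagonal, ← Complex.ofReal_sum, Complex.ofReal_re]

theorem prob_eq_sum_sqSingular {d : ℕ} (A : Matrix (Fin d) (Fin d) ℂ) :
    prob A = ∑ i, sqSingular A i := by
  obtain ⟨V, hV, h⟩ := exists_gram_diagonal A
  exact prob_eq_sum hV h

theorem eq_zero_of_prob {d : ℕ} {A : Matrix (Fin d) (Fin d) ℂ} (h : prob A = 0) : A = 0 := by
  unfold prob at h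
  rw [Finset.sum_eq_zero_iff_of_nonneg fun i _ => by positivity] at h
  ext i j
  have h1 := h i (Finset.mem_univ i)
  rw [Finset.sum_eq_zero_iff_of_nonneg fun i _ => by positivity] at h1
  simpa using h1 j (Finset.mem_univ j)

theorem prob_zero {d : ℕ} : prob (0 : Matrix (Fin d) (Fin d) ℂ) = 0 := by
  simp [prob]

theorem schmidt_eq {d : ℕ} (A : Matrix (Fin d) (Fin d) ℂ) (i : Fin d) :
    schmidt A i = (prob A)⁻¹ * sqSingular A i := by
  unfold schmidt
  rw [sqSingular_smul, inv_pow, Real.sq_sqrt (prob_nonneg A)]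

/-- The Schmidt vector of an outcome is read off from its Gram matrix. -/
theorem schmidt_of_gram {d : ℕ} {A V : Matrix (Fin d) (Fin d) ℂ} {y : Fin d → ℝ} {r : ℝ}
    (hr : 0 < r) (hy : IsSchmidt y) (hV : Vᴴ * V = 1)
    (h : Aᴴ * A = V * Matrix.diagonal (fun i => ((r * y i : ℝ) : ℂ)) * Vᴴ) (i : Fin d) :
    schmidt A i = desc y i := by
  rw [schmidt_eq, sqSingular_eq_desc hV h, desc_const_mul hr.le, prob_eq_sum hV h,
    ← Finset.mul_sum, hy.2, mul_one, inv_mul_cancel_left₀ hr.ne']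

/-! ### The `G`-concurrence -/

theorem elemSymm_top {d : ℕ} (x : Fin d → ℝ) : elemSymm d x = ∏ i, x i := by
  unfold elemSymm
  have h : Finset.powersetCard d (Finset.univ : Finset (Fin d)) = {Finset.univ} := by
    have := Finset.powersetCard_self (Finset.univ : Finset (Fin d))
    rwa [Finset.card_univ, Fintype.card_fin] at this
  rw [h, Finset.sum_singleton]

theorem gConcurrence_eq {d : ℕ} (hd : 0 < d) {x : Fin d → ℝ} (hx : ∀ i, 0 ≤ x i) :
    gConcurrence x = (d : ℝ) * (∏ i, x i) ^ (1 / (d : ℝ)) := by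
  have hd' : (0 : ℝ) < d := by exact_mod_cast hd
  unfold gConcurrence concurrence
  rw [elemSymm_top, elemSymm_top, Finset.prod_const, Finset.card_univ, Fintype.card_fin,
    one_div_pow, div_div_eq_mul_div, div_one,
    Real.mul_rpow (Finset.prod_nonneg fun i _ => hx i) (by positivity), ← Real.rpow_natCast,
    ← Real.rpow_mul hd'.le, mul_one_div_cancel hd'.ne', Real.rpow_one, mul_comm]

/-- The G-concurrence is homogeneous of degree one in the squared singular values, so the
probability cancels the normalization. For outcomes of probability zero both sides vanish. -/
theorem prob_mul_gConcurrence {d : ℕ} (hd : 0 < d) (A : Matrix (Fin d) (Fin d) ℂ) :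
    prob A * gConcurrence (schmidt A) = (d : ℝ) * (Aᴴ * A).det.re ^ (1 / (d : ℝ)) := by
  have hd' : (0 : ℝ) < d := by exact_mod_cast hd
  have h1 : (Aᴴ * A).det.re = ∏ i, sqSingular A i := by
    rw [prod_sqSingular, Matrix.det_mul, Matrix.det_conjTranspose, Complex.star_def,
      Complex.conj_mul', ← Complex.ofReal_pow, Complex.ofReal_re]
  have hnn : 0 ≤ ∏ i, sqSingular A i := Finset.prod_nonneg fun i _ => sqSingular_nonneg A i
  have hp := prob_nonneg A
  rw [gConcurrence_eq hd fun i => by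
    rw [schmidt_eq]; exact mul_nonneg (inv_nonneg.mpr hp) (sqSingular_nonneg A i), h1]
  rcases hp.eq_or_lt with h0 | hpos
  · have hA := eq_zero_of_prob h0.symm
    rw [prod_sqSingular, hA, prob_zero, zero_mul, show (0 : Matrix (Fin d) (Fin d) ℂ).det = 0 from haveI : Nonempty (Fin d) := ⟨⟨0, hd⟩⟩; Matrix.det_zero,
      norm_zero, zero_pow two_ne_zero, Real.zero_rpow (by positivity), mul_zero]
  · simp_rw [schmidt_eq]
    rw [Finset.prod_mul_distrib, Finset.prod_const, Finset.card_univ, Fintype.card_fin,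
      Real.mul_rpow (by positivity) hnn, ← Real.rpow_natCast, ← Real.rpow_mul (by positivity),
      mul_one_div_cancel hd'.ne', Real.rpow_one]
    field_simp

theorem averageG_eq {d : ℕ} (hd : 0 < d) (E : List (Matrix (Fin d) (Fin d) ℂ)) :
    averageG E = (E.map fun A => (d : ℝ) * (Aᴴ * A).det.re ^ (1 / (d : ℝ))).sum := by
  unfold averageG
  simp_rw [prob_mul_gConcurrence hd]

theorem averageG_flatten {d k : ℕ} (E : Fin k → List (Matrix (Fin d) (Fin d) ℂ)) :
    averageG (List.ofFn E).flatten = ∑ α, averageG (E α) := by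
  unfold averageG
  rw [List.map_flatten, List.sum_flatten, List.map_ofFn, List.map_ofFn, List.sum_ofFn]
  rfl

section

open scoped ComplexOrder

/-! ### Monotonicity of the potential under the steps of a protocol -/

/-- A weight at the left end is untouched by what happens at the right: one `W` serves all outcomes,
and completeness recombines the traces. -/
theorem sum_potential_measureRight {ι κ μ τ : Type} [Fintype ι] [Fintype κ] [DecidableEq κ]
    [Fintype μ] [Fintype τ] {d : ℕ} (A : Matrix ι κ ℂ) {N : τ → Matrix κ μ ℂ}
    (hN : ∑ a, N a * (N a)ᴴ = 1) :
    ∑ a, potential d ((A * N a) * (A * N a)ᴴ) ≤ potential d (A * Aᴴ) := by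
  refine le_potential fun W hW => ?_
  refine (Finset.sum_le_sum fun a _ => potential_le hW (posSemidef_factor' _)).trans
    (le_of_eq ?_)
  have h1 : ∀ a, W * ((A * N a) * (A * N a)ᴴ) = W * A * (N a * (N a)ᴴ) * Aᴴ := fun a => by
    simp only [Matrix.conjTranspose_mul, Matrix.mul_assoc]
  rw [← Complex.re_sum, ← Matrix.trace_sum, Finset.sum_congr rfl fun a _ => h1 a,
    ← Matrix.sum_mul, ← Matrix.mul_sum, hN, Matrix.mul_one, Matrix.mul_assoc]

theorem sum_potential_measureLeft {ι κ μ τ : Type} [Fintype ι] [DecidableEq ι] [Fintype κ]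
    [Fintype μ] [Fintype τ] {d : ℕ} (hd : 0 < d) (A : Matrix ι κ ℂ) {M : τ → Matrix μ ι ℂ}
    (hM : ∑ a, (M a)ᴴ * M a = 1) :
    ∑ a, potential d ((M a * A) * (M a * A)ᴴ) ≤ potential d (A * Aᴴ) := by
  have h := sum_potential_measureRight (d := d) Aᴴ (N := fun a => (M a)ᴴ)
    (by simpa only [Matrix.conjTranspose_conjTranspose] using hM)
  rw [Matrix.conjTranspose_conjTranspose, potential_gram_comm hd] at h
  refine le_trans (le_of_eq (Finset.sum_congr rfl fun a _ => ?_)) h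
  rw [← potential_gram_comm hd]
  simp only [Matrix.conjTranspose_mul, Matrix.conjTranspose_conjTranspose]

/-- The completeness relation of a swapping family, over any finite index type. -/
theorem sum_swapping_conj {ι κ τ : Type} [Fintype ι] [DecidableEq ι] [Fintype κ] [DecidableEq κ]
    [Fintype τ] {X : τ → Matrix ι κ ℂ}
    (hX : ∀ μ ν μ' ν', ∑ a, star (X a μ ν) * X a μ' ν' =
      (if μ = μ' then 1 else 0) * (if ν = ν' then 1 else 0)) (Z : Matrix κ κ ℂ) :
    ∑ a, X a * Z * (X a)ᴴ = Z.trace • (1 : Matrix ι ι ℂ) := by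
  ext μ μ'
  rw [Matrix.sum_apply]
  have h1 : ∀ a, (X a * Z * (X a)ᴴ) μ μ' =
      ∑ ν, ∑ ν', Z ν' ν * (star (X a μ' ν) * X a μ ν') := by
    intro a
    rw [Matrix.mul_apply]
    refine Finset.sum_congr rfl fun ν _ => ?_
    rw [Matrix.mul_apply, Finset.sum_mul, Matrix.conjTranspose_apply]
    exact Finset.sum_congr rfl fun ν' _ => by ring
  rw [Finset.sum_congr rfl fun a _ => h1 a, Finset.sum_comm]
  have h2 : ∀ ν, ∑ a, ∑ ν', Z ν' ν * (star (X a μ' ν) * X a μ ν') =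
      Z ν ν * (if μ' = μ then 1 else 0) := by
    intro ν
    rw [Finset.sum_comm]
    simp_rw [← Finset.mul_sum, hX]
    rw [Finset.sum_eq_single ν (fun b _ hb => by simp [hb.symm]) (by simp)]
    simp
  rw [Finset.sum_congr rfl fun ν _ => h2 ν, ← Finset.sum_mul]
  simp [Matrix.trace, Matrix.one_apply, eq_comm]

/-- Averaged over a swapping family, `X Z X†` becomes `tr Z` times the identity, which cuts the
two-sided trace into a product of one-sided traces. The real part factors because the trace with the
positive semidefinite `W` is real. -/
theorem sum_trace_swapping {ι κ μ ρ τ : Type} [Fintype ι] [Fintype κ] [DecidableEq κ] [Fintype μ]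
    [DecidableEq μ] [Fintype ρ] [Fintype τ] (A : Matrix ι κ ℂ) (B : Matrix μ ρ ℂ)
    {X : τ → Matrix κ μ ℂ}
    (hX : ∀ μ ν μ' ν', ∑ a, star (X a μ ν) * X a μ' ν' =
      (if μ = μ' then 1 else 0) * (if ν = ν' then 1 else 0)) {W : Matrix ι ι ℂ}
    {W' : Matrix ρ ρ ℂ} (hW : W.PosSemidef) :
    ∑ a, (W' * ((A * X a * B)ᴴ * W * (A * X a * B))).trace.re =
      (W * (A * Aᴴ)).trace.re * (W' * (Bᴴ * B)).trace.re := by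
  have h1 : ∀ a, (W' * ((A * X a * B)ᴴ * W * (A * X a * B))).trace =
      (Aᴴ * W * A * (X a * (B * W' * Bᴴ) * (X a)ᴴ)).trace := by
    intro a
    have h2 : W' * ((A * X a * B)ᴴ * W * (A * X a * B)) =
        (W' * Bᴴ * (X a)ᴴ) * (Aᴴ * W * A * X a * B) := by
      simp only [Matrix.conjTranspose_mul, Matrix.mul_assoc]
    have h3 : Aᴴ * W * A * (X a * (B * W' * Bᴴ) * (X a)ᴴ) =
        (Aᴴ * W * A * X a * B) * (W' * Bᴴ * (X a)ᴴ) := by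
      simp only [Matrix.mul_assoc]
    rw [h2, h3, Matrix.trace_mul_comm]
  have h4 : (Aᴴ * W * A).trace = (W * (A * Aᴴ)).trace := by
    rw [Matrix.mul_assoc, Matrix.trace_mul_comm, Matrix.mul_assoc]
  have h5 : (B * W' * Bᴴ).trace = (W' * (Bᴴ * B)).trace := by
    rw [Matrix.mul_assoc, Matrix.trace_mul_comm, Matrix.mul_assoc]
  have h6 : (W * (A * Aᴴ)).trace.im = 0 := by
    rw [← h4]
    exact posSemidef_trace_im (hW.conjTranspose_mul_mul_same A)
  rw [← Complex.re_sum, Finset.sum_congr rfl fun a _ => h1 a, ← Matrix.trace_sum,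
    ← Matrix.mul_sum, sum_swapping_conj hX, Matrix.mul_smul, Matrix.mul_one, Matrix.trace_smul,
    h4, h5, smul_eq_mul, Complex.mul_re, h6]
  ring

/-- Independent weights at the two outer ends bound every outcome at once; their summed traces
factor, and the two infima are then taken one after the other. -/
theorem sum_potential_swap {ι κ μ ρ τ : Type} [Fintype ι] [Fintype κ] [DecidableEq κ] [Fintype μ]
    [DecidableEq μ] [Fintype ρ] [Fintype τ] {d : ℕ} (hd : 0 < d) (A : Matrix ι κ ℂ)
    (B : Matrix μ ρ ℂ) {X : τ → Matrix κ μ ℂ}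
    (hX : ∀ μ ν μ' ν', ∑ a, star (X a μ ν) * X a μ' ν' =
      (if μ = μ' then 1 else 0) * (if ν = ν' then 1 else 0)) :
    ∑ a, potential d ((A * X a * B) * (A * X a * B)ᴴ) ≤
      potential d (A * Aᴴ) * potential d (B * Bᴴ) := by
  refine le_potential_mul (potential_nonneg (posSemidef_factor' B)) fun W hW => ?_
  rw [mul_comm, ← potential_gram_comm hd B]
  refine le_potential_mul (posSemidef_trace_mul_re_nonneg hW.1 (posSemidef_factor' A))
    fun W' hW' => ?_
  rw [mul_comm, ← sum_trace_swapping A B hX hW.1]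
  exact Finset.sum_le_sum fun a _ => potential_le_two_sided hd _ hW hW'

theorem det_rpow_le_potential {d : ℕ} (hd : 0 < d) (A : Matrix (Fin d) (Fin d) ℂ) :
    (d : ℝ) * (Aᴴ * A).det.re ^ (1 / (d : ℝ)) ≤ potential d (A * Aᴴ) := by
  have h := roof_le_potential hd A (τ := Unit) (L := fun _ => 1) (by simp)
  simpa using h

/-- The potential of a link. -/
def linkPotential (d : ℕ) (a : Link) : ℝ := potential d (a.amp * a.ampᴴ)

theorem linkPotential_nonneg (d : ℕ) (a : Link) : 0 ≤ linkPotential d a :=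
  potential_nonneg (posSemidef_factor' _)

theorem sum_transpose_measurement {ι κ : Type} [Fintype ι] [DecidableEq ι] [Fintype κ] {k : ℕ}
    {M : Fin k → Matrix κ ι ℂ} (hM : IsMeasurement M) : ∑ a, (M a)ᵀ * ((M a)ᵀ)ᴴ = 1 := by
  have h : ∀ a, (M a)ᵀ * ((M a)ᵀ)ᴴ = ((M a)ᴴ * M a)ᵀ := fun a => by
    rw [Matrix.transpose_mul]
    rfl
  rw [Finset.sum_congr rfl fun a _ => h a, ← Matrix.transpose_sum]
  rw [show ∑ a, (M a)ᴴ * M a = 1 from hM, Matrix.transpose_one]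

theorem prod_map_nonneg (d : ℕ) (L : List Link) : 0 ≤ (L.map (linkPotential d)).prod :=
  List.prod_nonneg fun r hr => by
    obtain ⟨a, -, rfl⟩ := List.mem_map.mp hr
    exact linkPotential_nonneg d a

/-- No protocol exceeds the product of the potentials of its links. -/
theorem Produces.averageG_le {d : ℕ} (hd : 0 < d) {L : List Link}
    {E : List (Matrix (Fin d) (Fin d) ℂ)} (h : Produces d L E) :
    averageG E ≤ (L.map (linkPotential d)).prod := by
  induction h with
  | done A =>
    rw [averageG_eq hd]
    simpa [linkPotential] using det_rpow_le_potential hd A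
  | swap pre post a b k X hX E hE ih =>
    rw [averageG_flatten]
    refine (Finset.sum_le_sum fun α _ => ih α).trans ?_
    simp only [List.map_append, List.map_cons, List.prod_append, List.prod_cons]
    rw [← Finset.mul_sum, ← Finset.sum_mul, ← mul_assoc (linkPotential d a)]
    exact mul_le_mul_of_nonneg_left (mul_le_mul_of_nonneg_right
      (sum_potential_swap hd a.amp b.amp hX) (prod_map_nonneg d post)) (prod_map_nonneg d pre)
  | measureLeft pre post a κ k M hM E hE ih =>
    rw [averageG_flatten]
    refine (Finset.sum_le_sum fun α _ => ih α).trans ?_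
    simp only [List.map_append, List.map_cons, List.prod_append, List.prod_cons]
    rw [← Finset.mul_sum, ← Finset.sum_mul]
    exact mul_le_mul_of_nonneg_left (mul_le_mul_of_nonneg_right
      (sum_potential_measureLeft hd a.amp hM) (prod_map_nonneg d post)) (prod_map_nonneg d pre)
  | measureRight pre post a κ k M hM E hE ih =>
    rw [averageG_flatten]
    refine (Finset.sum_le_sum fun α _ => ih α).trans ?_
    simp only [List.map_append, List.map_cons, List.prod_append, List.prod_cons]
    rw [← Finset.mul_sum, ← Finset.sum_mul]
    exact mul_le_mul_of_nonneg_left (mul_le_mul_of_nonneg_right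
      (sum_potential_measureRight a.amp (sum_transpose_measurement hM)) (prod_map_nonneg d post))
      (prod_map_nonneg d pre)

/-! ### Conservation of probability -/

/-- The squared Hilbert-Schmidt norm of a link. -/
def linkProb (a : Link) : ℝ := (a.ampᴴ * a.amp).trace.re

theorem sum_map_prob_flatten {d k : ℕ} (E : Fin k → List (Matrix (Fin d) (Fin d) ℂ)) :
    ((List.ofFn E).flatten.map prob).sum = ∑ α, ((E α).map prob).sum := by
  rw [List.map_flatten, List.sum_flatten, List.map_ofFn, List.map_ofFn, List.sum_ofFn]
  rfl

/-- The trace identities above with the weight `1`. It fixes the total probability, which turns a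
deterministic Schmidt vector into a value of the average. -/
theorem Produces.sum_prob {d : ℕ} {L : List Link} {E : List (Matrix (Fin d) (Fin d) ℂ)}
    (h : Produces d L E) : (E.map prob).sum = (L.map linkProb).prod := by
  induction h with
  | done A => simp [linkProb, prob_eq_trace]
  | swap pre post a b k X hX E hE ih =>
    rw [sum_map_prob_flatten, Finset.sum_congr rfl fun α _ => ih α]
    simp only [List.map_append, List.map_cons, List.prod_append, List.prod_cons]
    rw [← Finset.mul_sum, ← Finset.sum_mul, ← mul_assoc (linkProb a)]
    congr 2
    have h1 := sum_trace_swapping a.amp b.amp hX (W := 1) (W' := 1) (admissible_one d).1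
    simp only [Matrix.one_mul, Matrix.mul_one] at h1
    rw [Matrix.trace_mul_comm a.amp] at h1
    exact h1
  | measureLeft pre post a κ k M hM E hE ih =>
    rw [sum_map_prob_flatten, Finset.sum_congr rfl fun α _ => ih α]
    simp only [List.map_append, List.map_cons, List.prod_append, List.prod_cons]
    rw [← Finset.mul_sum, ← Finset.sum_mul]
    congr 2
    unfold linkProb
    have h1 : ∀ α, (M α * a.amp)ᴴ * (M α * a.amp) = a.ampᴴ * ((M α)ᴴ * M α) * a.amp := fun α => by
      simp only [Matrix.conjTranspose_mul, Matrix.mul_assoc]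
    rw [← Complex.re_sum, ← Matrix.trace_sum, Finset.sum_congr rfl fun α _ => h1 α,
      ← Matrix.sum_mul, ← Matrix.mul_sum, show ∑ a, (M a)ᴴ * M a = 1 from hM, Matrix.mul_one]
  | measureRight pre post a κ k M hM E hE ih =>
    rw [sum_map_prob_flatten, Finset.sum_congr rfl fun α _ => ih α]
    simp only [List.map_append, List.map_cons, List.prod_append, List.prod_cons]
    rw [← Finset.mul_sum, ← Finset.sum_mul]
    congr 2
    unfold linkProb
    have h1 : ∀ α, ((a.amp * (M α)ᵀ)ᴴ * (a.amp * (M α)ᵀ)).trace =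
        (a.amp * ((M α)ᵀ * ((M α)ᵀ)ᴴ) * a.ampᴴ).trace := fun α => by
      rw [Matrix.trace_mul_comm]
      simp only [Matrix.conjTranspose_mul, Matrix.mul_assoc]
    rw [← Complex.re_sum, Finset.sum_congr rfl fun α _ => h1 α, ← Matrix.trace_sum,
      ← Matrix.sum_mul, ← Matrix.mul_sum, sum_transpose_measurement hM, Matrix.mul_one,
      Matrix.trace_mul_comm]

/-! ### The Fourier matrix and generalized Pauli matrices -/

/-- The standard primitive `d`-th root of unity. -/
def rootOfUnity (d : ℕ) : ℂ := Complex.exp (2 * (Real.pi : ℂ) * Complex.I / (d : ℂ))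

theorem star_rootOfUnity (d : ℕ) : star (rootOfUnity d) = (rootOfUnity d)⁻¹ := by
  unfold rootOfUnity
  rw [Complex.star_def, ← Complex.exp_conj, ← Complex.exp_neg]
  congr 1
  simp only [map_div₀, map_mul, Complex.conj_ofReal, Complex.conj_I, map_natCast, map_ofNat]
  ring

theorem rootOfUnity_ne_zero (d : ℕ) : rootOfUnity d ≠ 0 := Complex.exp_ne_zero _

theorem norm_rootOfUnity (d : ℕ) : ‖rootOfUnity d‖ = 1 := by
  have h : rootOfUnity d = Complex.exp (((2 * Real.pi / d : ℝ) : ℂ) * Complex.I) := by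
    unfold rootOfUnity
    congr 1
    push_cast
    ring
  rw [h, Complex.norm_exp_ofReal_mul_I]

theorem fourier_apply (d : ℕ) (μ ν : Fin d) : fourier d μ ν =
    ((Real.sqrt d : ℝ) : ℂ)⁻¹ * (rootOfUnity d)⁻¹ ^ (((μ : ℕ) + 1) * ((ν : ℕ) + 1)) := by
  unfold fourier rootOfUnity
  rw [← Complex.exp_neg, ← Complex.exp_nat_mul]
  congr 2
  push_cast
  ring

theorem norm_fourier_sq {d : ℕ} (μ ν : Fin d) : ‖fourier d μ ν‖ ^ 2 = (d : ℝ)⁻¹ := by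
  rw [fourier_apply, norm_mul, norm_pow, norm_inv, norm_inv, norm_rootOfUnity, inv_one, one_pow,
    mul_one, Complex.norm_real, Real.norm_of_nonneg (Real.sqrt_nonneg _), inv_pow,
    Real.sq_sqrt (Nat.cast_nonneg d)]

theorem sum_rootOfUnity {d : ℕ} (hd : 0 < d) (a b : Fin d) :
    ∑ k : Fin d, star (rootOfUnity d ^ ((k : ℕ) * a)) * rootOfUnity d ^ ((k : ℕ) * b) =
      if a = b then (d : ℂ) else 0 := by
  have hprim : IsPrimitiveRoot (rootOfUnity d) d := Complex.isPrimitiveRoot_exp d hd.ne'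
  have h0 := rootOfUnity_ne_zero d
  have h1 : ∀ k : Fin d, star (rootOfUnity d ^ ((k : ℕ) * a)) * rootOfUnity d ^ ((k : ℕ) * b) =
      ((rootOfUnity d ^ (a : ℕ))⁻¹ * rootOfUnity d ^ (b : ℕ)) ^ (k : ℕ) := by
    intro k
    rw [star_pow, star_rootOfUnity, mul_comm (k : ℕ), pow_mul, mul_comm (k : ℕ), pow_mul,
      ← mul_pow, inv_pow]
  rw [Finset.sum_congr rfl fun k _ => h1 k]
  split_ifs with hab
  · rw [hab, inv_mul_cancel₀ (pow_ne_zero _ h0)]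
    simp
  · set η := (rootOfUnity d ^ (a : ℕ))⁻¹ * rootOfUnity d ^ (b : ℕ) with hη
    have hne : η ≠ 1 := by
      intro h
      rw [hη, inv_mul_eq_one₀ (pow_ne_zero _ h0)] at h
      exact hab (Fin.ext (hprim.pow_inj a.2 b.2 h))
    have hpow : η ^ d = 1 := by
      rw [hη, mul_pow, inv_pow, ← pow_mul, ← pow_mul, mul_comm (a : ℕ), mul_comm (b : ℕ), pow_mul,
        pow_mul, hprim.pow_eq_one]
      simp
    rw [← Finset.sum_range (fun k => η ^ k), geom_sum_eq hne, hpow]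
    simp

theorem fourier_conjTranspose_mul {d : ℕ} (hd : 0 < d) : (fourier d)ᴴ * fourier d = 1 := by
  have hd' : (d : ℂ) ≠ 0 := by exact_mod_cast hd.ne'
  ext a b
  rw [Matrix.mul_apply]
  -- The indices start from one in the exponents; this only produces a prefactor independent of `k`,
  -- equal to `1 / d` on the diagonal.
  have h1 : ∀ k : Fin d, (fourier d)ᴴ a k * fourier d k b =
      (d : ℂ)⁻¹ * (rootOfUnity d ^ ((a : ℕ) + 1) * (rootOfUnity d)⁻¹ ^ ((b : ℕ) + 1)) *
      (star (rootOfUnity d ^ ((k : ℕ) * b)) * rootOfUnity d ^ ((k : ℕ) * a)) := by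
    intro k
    rw [Matrix.conjTranspose_apply, fourier_apply, fourier_apply, StarMul.star_mul, star_pow,
      star_pow, star_inv₀, star_inv₀, star_rootOfUnity, inv_inv, Complex.star_def,
      Complex.conj_ofReal]
    have h2 : ((Real.sqrt d : ℝ) : ℂ)⁻¹ * ((Real.sqrt d : ℝ) : ℂ)⁻¹ = (d : ℂ)⁻¹ := by
      rw [← mul_inv, ← Complex.ofReal_mul, Real.mul_self_sqrt (Nat.cast_nonneg d),
        Complex.ofReal_natCast]
    have h3 : rootOfUnity d ^ (k : ℕ) * (rootOfUnity d)⁻¹ ^ (k : ℕ) = 1 := by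
      rw [← mul_pow, mul_inv_cancel₀ (rootOfUnity_ne_zero d), one_pow]
    rw [← h2]
    linear_combination (((Real.sqrt d : ℝ) : ℂ)⁻¹ ^ 2 * rootOfUnity d ^ ((k : ℕ) * a + a + 1) *
      (rootOfUnity d)⁻¹ ^ ((k : ℕ) * b + b + 1)) * h3
  rw [Finset.sum_congr rfl fun k _ => h1 k, ← Finset.mul_sum, sum_rootOfUnity hd]
  by_cases hab : a = b
  · subst hab
    rw [if_pos rfl, Matrix.one_apply_eq, ← mul_pow, mul_inv_cancel₀ (rootOfUnity_ne_zero d)]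
    field_simp
    simp
  · rw [if_neg (Ne.symm hab), Matrix.one_apply_ne hab, mul_zero]

/-- Powers of the clock matrix. -/
def clock (d : ℕ) (j : Fin d) : Matrix (Fin d) (Fin d) ℂ :=
  Matrix.diagonal fun μ => rootOfUnity d ^ ((j : ℕ) * μ)

theorem clock_conjTranspose_mul (d : ℕ) (j : Fin d) : (clock d j)ᴴ * clock d j = 1 := by
  unfold clock
  rw [Matrix.diagonal_conjTranspose, Matrix.diagonal_mul_diagonal, ← Matrix.diagonal_one]
  congr 1
  funext μ
  rw [Pi.star_apply, Complex.star_def, Complex.conj_mul', norm_pow, norm_rootOfUnity]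
  simp

/-! ### Swapping families -/

theorem IsSwapping.of_fintype {ι κ τ : Type} [DecidableEq ι] [DecidableEq κ] [Fintype τ]
    {X : τ → Matrix ι κ ℂ}
    (hX : ∀ μ ν μ' ν', ∑ a, star (X a μ ν) * X a μ' ν' =
      (if μ = μ' then 1 else 0) * (if ν = ν' then 1 else 0)) :
    IsSwapping fun a : Fin (Fintype.card τ) => X ((Fintype.equivFin τ).symm a) := by
  intro μ ν μ' ν'
  rw [← hX]
  exact (Fintype.equivFin τ).symm.sum_comp fun a => star (X a μ ν) * X a μ' ν'

theorem IsSwapping.unitary_mul {ι κ : Type} [Fintype ι] [DecidableEq ι] [DecidableEq κ] {k : ℕ}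
    {X : Fin k → Matrix ι κ ℂ} (hX : IsSwapping X) {V : Matrix ι ι ℂ} (hV : V * Vᴴ = 1) :
    IsSwapping fun a => V * X a := by
  intro μ ν μ' ν'
  have h1 : ∀ a, star ((V * X a) μ ν) * (V * X a) μ' ν' =
      ∑ ρ, ∑ ρ', star (V μ ρ) * V μ' ρ' * (star (X a ρ ν) * X a ρ' ν') := by
    intro a
    rw [Matrix.mul_apply, Matrix.mul_apply, star_sum, Finset.sum_mul]
    refine Finset.sum_congr rfl fun ρ _ => ?_
    rw [Finset.mul_sum]
    refine Finset.sum_congr rfl fun ρ' _ => ?_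
    rw [StarMul.star_mul]
    ring
  rw [Finset.sum_congr rfl fun a _ => h1 a, Finset.sum_comm]
  have h2 : ∀ ρ, ∑ a, ∑ ρ', star (V μ ρ) * V μ' ρ' * (star (X a ρ ν) * X a ρ' ν') =
      V μ' ρ * star (V μ ρ) * (if ν = ν' then 1 else 0) := by
    intro ρ
    rw [Finset.sum_comm]
    simp_rw [← Finset.mul_sum]
    rw [Finset.sum_congr rfl fun ρ' _ => congrArg _ (hX ρ ν ρ' ν')]
    rw [Finset.sum_eq_single ρ (fun b _ hb => by simp [hb.symm]) (by simp)]
    rw [if_pos rfl]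
    ring
  rw [Finset.sum_congr rfl fun ρ _ => h2 ρ, ← Finset.sum_mul]
  congr 1
  have h3 := congrFun (congrFun hV μ') μ
  rw [Matrix.mul_apply] at h3
  simp only [Matrix.conjTranspose_apply] at h3
  rw [h3, Matrix.one_apply]
  simp [eq_comm]

/-- Summing over the clock powers on either side yields a Kronecker delta in the row index and one
in the column index, each with a factor `d`. These cancel the scale `1 / d` of the family and the
squared modulus `1 / d` common to all Fourier entries. -/
theorem sum_star_pauli {d : ℕ} (hd : 0 < d) (μ ν μ' ν' : Fin d) :
    ∑ a : Fin d × Fin d,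
      star ((((Real.sqrt d : ℝ) : ℂ)⁻¹ • (clock d a.1 * fourier d * clock d a.2)) μ ν) *
        (((Real.sqrt d : ℝ) : ℂ)⁻¹ • (clock d a.1 * fourier d * clock d a.2)) μ' ν' =
      (if μ = μ' then 1 else 0) * (if ν = ν' then 1 else 0) := by
  have hd' : (d : ℂ) ≠ 0 := by exact_mod_cast hd.ne'
  have h1 : ∀ a : Fin d × Fin d,
      star ((((Real.sqrt d : ℝ) : ℂ)⁻¹ • (clock d a.1 * fourier d * clock d a.2)) μ ν) *
        (((Real.sqrt d : ℝ) : ℂ)⁻¹ • (clock d a.1 * fourier d * clock d a.2)) μ' ν' =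
      (d : ℂ)⁻¹ * (star (fourier d μ ν) * fourier d μ' ν') *
      ((star (rootOfUnity d ^ ((a.1 : ℕ) * μ)) * rootOfUnity d ^ ((a.1 : ℕ) * μ')) *
      (star (rootOfUnity d ^ ((a.2 : ℕ) * ν)) * rootOfUnity d ^ ((a.2 : ℕ) * ν'))) := by
    intro a
    have h2 : ((Real.sqrt d : ℝ) : ℂ)⁻¹ * ((Real.sqrt d : ℝ) : ℂ)⁻¹ = (d : ℂ)⁻¹ := by
      rw [← mul_inv, ← Complex.ofReal_mul, Real.mul_self_sqrt (Nat.cast_nonneg d),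
        Complex.ofReal_natCast]
    simp only [clock, Matrix.smul_apply, Matrix.mul_diagonal, Matrix.diagonal_mul, smul_eq_mul,
      StarMul.star_mul, star_inv₀, Complex.star_def, Complex.conj_ofReal]
    rw [← h2]
    ring
  rw [Finset.sum_congr rfl fun a _ => h1 a, ← Finset.mul_sum, Fintype.sum_prod_type]
  simp_rw [← Finset.mul_sum, ← Finset.sum_mul]
  rw [sum_rootOfUnity hd, sum_rootOfUnity hd]
  by_cases hμ : μ = μ'
  · by_cases hν : ν = ν'
    · subst hμ hν
      rw [if_pos rfl, if_pos rfl, if_pos rfl, if_pos rfl, Complex.star_def, Complex.conj_mul',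
        ← Complex.ofReal_pow, norm_fourier_sq]
      push_cast
      field_simp
    · simp [hν]
  · simp [hμ]

/-! ### The swapping function -/

theorem sqrtDiag_desc {d : ℕ} {x : Fin d → ℝ} (hx : Antitone x) :
    sqrtDiag (fun j : Fin d => desc x j) = sqrtDiag x := by
  congr 1
  funext j
  exact desc_eq_self hx j

theorem swapFun_antitone {d : ℕ} (x y : Fin d → ℝ) : Antitone (swapFun x y) := fun _ _ hab =>
  mul_le_mul_of_nonneg_left (sqSingular_antitone _ hab) (Nat.cast_nonneg d)

theorem swapFun_nonneg {d : ℕ} (x y : Fin d → ℝ) (i : Fin d) : 0 ≤ swapFun x y i :=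
  mul_nonneg (Nat.cast_nonneg d) (sqSingular_nonneg _ i)

theorem sum_desc {d : ℕ} (x : Fin d → ℝ) : ∑ l : Fin d, desc x l = ∑ l, x l := by
  obtain ⟨σ, hσ⟩ := exists_perm_desc x
  rw [Finset.sum_congr rfl fun l _ => hσ l]
  exact Equiv.sum_comp σ x

theorem desc_nonneg {d : ℕ} {x : Fin d → ℝ} (hx : ∀ i, 0 ≤ x i) (l : Fin d) : 0 ≤ desc x l :=
  (desc_antitone_nonneg hx).2 l

/-- All Fourier entries have squared modulus `1 / d`, so the squared Hilbert-Schmidt norm is `1 /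
d`; the prefactor in the swapping function restores the normalization. -/
theorem isSchmidt_swapFun {d : ℕ} (hd : 0 < d) {x y : Fin d → ℝ} (hx : IsSchmidt x)
    (hy : IsSchmidt y) : IsSchmidt (swapFun x y) := by
  have hd' : (d : ℝ) ≠ 0 := by exact_mod_cast hd.ne'
  refine ⟨swapFun_nonneg x y, ?_⟩
  unfold swapFun
  rw [← Finset.mul_sum, ← prob_eq_sum_sqSingular]
  unfold prob
  have h1 : ∀ i j : Fin d, ‖(sqrtDiag (fun j : Fin d => desc x j) * fourier d *
      sqrtDiag (fun j : Fin d => desc y j)) i j‖ ^ 2 = desc x i * ((d : ℝ)⁻¹ * desc y j) := by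
    intro i j
    simp only [sqrtDiag, Matrix.mul_diagonal, Matrix.diagonal_mul]
    rw [norm_mul, norm_mul, mul_pow, mul_pow, norm_fourier_sq, Complex.norm_real,
      Complex.norm_real, Real.norm_of_nonneg (Real.sqrt_nonneg _),
      Real.norm_of_nonneg (Real.sqrt_nonneg _), Real.sq_sqrt (desc_nonneg hx.1 i),
      Real.sq_sqrt (desc_nonneg hy.1 j), mul_assoc]
  simp_rw [h1, ← Finset.mul_sum, sum_desc, hy.2]
  rw [← Finset.sum_mul, sum_desc, hx.2]
  field_simp

/-- Determinants multiply and the Fourier matrix is unitary; the factor `d` on each entry supplies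
the second prefactor `d` of the product. -/
theorem gConcurrence_swapFun {d : ℕ} (hd : 0 < d) {x y : Fin d → ℝ} (hx : ∀ i, 0 ≤ x i)
    (hy : ∀ i, 0 ≤ y i) : gConcurrence (swapFun x y) = gConcurrence x * gConcurrence y := by
  have hd' : (0 : ℝ) < d := by exact_mod_cast hd
  have hxp : 0 ≤ ∏ i, x i := Finset.prod_nonneg fun i _ => hx i
  have hyp : 0 ≤ ∏ i, y i := Finset.prod_nonneg fun i _ => hy i
  have hdet : ‖(fourier d).det‖ ^ 2 = 1 := by
    have h := congrArg Matrix.det (fourier_conjTranspose_mul hd)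
    rw [Matrix.det_mul, Matrix.det_conjTranspose, Matrix.det_one, Complex.star_def,
      Complex.conj_mul'] at h
    exact_mod_cast h
  have hsq : ∀ z : Fin d → ℝ, (∀ i, 0 ≤ z i) →
      ‖(sqrtDiag (fun j : Fin d => desc z j)).det‖ ^ 2 = ∏ i, z i := by
    intro z hz
    rw [sqrtDiag, Matrix.det_diagonal, norm_prod, ← Finset.prod_pow, ← prod_desc z]
    refine Finset.prod_congr rfl fun i _ => ?_
    rw [Complex.norm_real, Real.norm_of_nonneg (Real.sqrt_nonneg _),
      Real.sq_sqrt (desc_nonneg hz i)]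
  have h1 : ∏ i, swapFun x y i = (d : ℝ) ^ d * ((∏ i, x i) * ∏ i, y i) := by
    unfold swapFun
    rw [Finset.prod_mul_distrib, prod_sqSingular, Matrix.det_mul, Matrix.det_mul, norm_mul,
      norm_mul, mul_pow, mul_pow, hdet, hsq x hx, hsq y hy, Finset.prod_const, Finset.card_univ,
      Fintype.card_fin, mul_one]
  rw [gConcurrence_eq hd (swapFun_nonneg x y), gConcurrence_eq hd hx, gConcurrence_eq hd hy, h1,
    Real.mul_rpow (by positivity) (mul_nonneg hxp hyp), Real.mul_rpow hxp hyp,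
    ← Real.rpow_natCast, ← Real.rpow_mul hd'.le, mul_one_div_cancel hd'.ne', Real.rpow_one]
  ring

theorem schmidt_antitone {d : ℕ} (A : Matrix (Fin d) (Fin d) ℂ) : Antitone (schmidt A) :=
  sqSingular_antitone _

theorem isSchmidt_schmidt {d : ℕ} {A : Matrix (Fin d) (Fin d) ℂ} (hA : prob A ≠ 0) :
    IsSchmidt (schmidt A) := by
  refine ⟨fun i => sqSingular_nonneg _ i, ?_⟩
  simp_rw [schmidt_eq]
  rw [← Finset.mul_sum, ← prob_eq_sum_sqSingular, inv_mul_cancel₀ hA]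

/-- A swapping family that acts deterministically on the Schmidt vectors, by the swapping
function. -/
theorem exists_deterministic_swapping {d : ℕ} (hd : 0 < d) (A : Matrix (Fin d) (Fin d) ℂ)
    {y : Fin d → ℝ} (hy : IsSchmidt y) (hya : Antitone y) :
    ∃ (k : ℕ) (X : Fin k → Matrix (Fin d) (Fin d) ℂ), IsSwapping X ∧
      ∀ (a : Fin k) (c : ℝ), prob (A * X a * ((c : ℂ) • sqrtDiag y)) ≠ 0 →
        prob A ≠ 0 ∧ schmidt (A * X a * ((c : ℂ) • sqrtDiag y)) = swapFun (schmidt A) y := by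
  have hd' : (0 : ℝ) < d := by exact_mod_cast hd
  obtain ⟨V, hV, hA⟩ := exists_gram_diagonal A
  let X0 : Fin d × Fin d → Matrix (Fin d) (Fin d) ℂ := fun a =>
    ((Real.sqrt d : ℝ) : ℂ)⁻¹ • (clock d a.1 * fourier d * clock d a.2)
  refine ⟨_, _, (IsSwapping.of_fintype (X := X0) (sum_star_pauli hd)).unitary_mul
    (mul_eq_one_comm.mp hV), fun a c hp => ?_⟩
  set jk := (Fintype.equivFin (Fin d × Fin d)).symm a
  have hpA : prob A ≠ 0 := by
    intro h
    rw [eq_zero_of_prob h, Matrix.zero_mul, Matrix.zero_mul, prob_zero] at hp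
    exact hp rfl
  have hc : c ≠ 0 := by
    rintro rfl
    rw [Complex.ofReal_zero, zero_smul, Matrix.mul_zero, prob_zero] at hp
    exact hp rfl
  refine ⟨hpA, ?_⟩
  have hpp : 0 < prob A := lt_of_le_of_ne (prob_nonneg A) (Ne.symm hpA)
  have hx := isSchmidt_schmidt hpA
  set x := schmidt A with hxdef
  set B := sqrtDiag (fun j : Fin d => desc x j) * fourier d *
    sqrtDiag (fun j : Fin d => desc y j) with hB
  obtain ⟨U, hU, hBU⟩ := exists_gram_diagonal B
  have hB' : B = sqrtDiag x * fourier d * sqrtDiag y := by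
    rw [hB, sqrtDiag_desc hya, sqrtDiag_desc (schmidt_antitone A)]
  have hBB : Bᴴ * B = sqrtDiag y * (fourier d)ᴴ * Matrix.diagonal (fun i => (x i : ℂ)) *
      fourier d * sqrtDiag y := by
    rw [hB', ← sqrtDiag_mul_sqrtDiag hx.1]
    simp only [Matrix.conjTranspose_mul, sqrtDiag_conjTranspose, Matrix.mul_assoc]
  have hAx : Matrix.diagonal (fun i => (sqSingular A i : ℂ)) =
      ((prob A : ℝ) : ℂ) • Matrix.diagonal (fun i => (x i : ℂ)) := by
    rw [← Matrix.diagonal_smul]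
    congr 1
    funext i
    rw [Pi.smul_apply, smul_eq_mul, ← Complex.ofReal_mul, hxdef, schmidt_eq,
      mul_inv_cancel_left₀ hpA]
  have hcomm : clock d jk.2 * sqrtDiag y = sqrtDiag y * clock d jk.2 := by
    simp only [clock, sqrtDiag, Matrix.diagonal_mul_diagonal, mul_comm]
  -- The left clock phase cancels in the Gram matrix because it commutes with the diagonal; the
  -- right one survives only as a unitary conjugation. Neither affects the spectrum, so all outcomes
  -- agree.
  have hdcomm : (clock d jk.1)ᴴ * Matrix.diagonal (fun i => (x i : ℂ)) * clock d jk.1 =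
      Matrix.diagonal (fun i => (x i : ℂ)) := by
    have h1 : (clock d jk.1)ᴴ * Matrix.diagonal (fun i => (x i : ℂ)) =
        Matrix.diagonal (fun i => (x i : ℂ)) * (clock d jk.1)ᴴ := by
      simp only [clock, Matrix.diagonal_conjTranspose, Matrix.diagonal_mul_diagonal, mul_comm]
    rw [h1, Matrix.mul_assoc, clock_conjTranspose_mul, Matrix.mul_one]
  -- The probability of the outcome: the total `c ^ 2 * prob A`, shared equally by the `d ^ 2`
  -- outcomes.
  set r : ℝ := c ^ 2 * prob A / (d : ℝ) ^ 2 with hr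
  have hrpos : 0 < r := by positivity
  set s : ℂ := (c : ℂ) * ((Real.sqrt d : ℝ) : ℂ)⁻¹ with hs
  have hout : A * (V * X0 jk) * ((c : ℂ) • sqrtDiag y) =
      s • (A * V * clock d jk.1 * fourier d * sqrtDiag y * clock d jk.2) := by
    simp only [X0, Matrix.mul_smul, Matrix.smul_mul, smul_smul, Matrix.mul_assoc, hcomm, hs]
  have hss : star s * s = ((c ^ 2 / d : ℝ) : ℂ) := by
    rw [hs, StarMul.star_mul, star_inv₀, Complex.star_def, Complex.conj_ofReal,
      Complex.conj_ofReal]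
    have h2 : ((Real.sqrt d : ℝ) : ℂ)⁻¹ * ((Real.sqrt d : ℝ) : ℂ)⁻¹ = (d : ℂ)⁻¹ := by
      rw [← mul_inv, ← Complex.ofReal_mul, Real.mul_self_sqrt (Nat.cast_nonneg d),
        Complex.ofReal_natCast]
    push_cast
    rw [div_eq_mul_inv, ← h2]
    ring
  have hgram : (A * (V * X0 jk) * ((c : ℂ) • sqrtDiag y))ᴴ *
      (A * (V * X0 jk) * ((c : ℂ) • sqrtDiag y)) =
      ((clock d jk.2)ᴴ * U) * Matrix.diagonal (fun i => ((r * swapFun x y i : ℝ) : ℂ)) *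
        ((clock d jk.2)ᴴ * U)ᴴ := by
    have h3 : (Matrix.diagonal fun i => ((r * swapFun x y i : ℝ) : ℂ)) =
        (((c ^ 2 / d : ℝ) : ℂ) * ((prob A : ℝ) : ℂ)) •
          Matrix.diagonal fun i => (sqSingular B i : ℂ) := by
      rw [← Matrix.diagonal_smul]
      congr 1
      funext i
      rw [Pi.smul_apply, smul_eq_mul, ← Complex.ofReal_mul, ← Complex.ofReal_mul]
      congr 1
      rw [hr, show swapFun x y i = (d : ℝ) * sqSingular B i from rfl]
      field_simp
    have h4 : (A * V * clock d jk.1 * fourier d * sqrtDiag y * clock d jk.2)ᴴ *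
        (A * V * clock d jk.1 * fourier d * sqrtDiag y * clock d jk.2) =
        ((prob A : ℝ) : ℂ) • ((clock d jk.2)ᴴ * (Bᴴ * B) * clock d jk.2) := by
      have h5 : (A * V * clock d jk.1 * fourier d * sqrtDiag y * clock d jk.2)ᴴ *
          (A * V * clock d jk.1 * fourier d * sqrtDiag y * clock d jk.2) =
          (clock d jk.2)ᴴ * (sqrtDiag y * (fourier d)ᴴ * ((clock d jk.1)ᴴ * (Vᴴ * (Aᴴ * A) * V) *
          clock d jk.1) * fourier d * sqrtDiag y) * clock d jk.2 := by
        simp only [Matrix.conjTranspose_mul, sqrtDiag_conjTranspose, Matrix.mul_assoc]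
      have h6 : Vᴴ * (Aᴴ * A) * V = ((prob A : ℝ) : ℂ) • Matrix.diagonal (fun i => (x i : ℂ)) := by
        rw [hA, hAx, Matrix.mul_assoc, Matrix.mul_assoc, hV, Matrix.mul_one, ← Matrix.mul_assoc,
          hV, Matrix.one_mul]
      rw [h5, h6, Matrix.mul_smul, Matrix.smul_mul, hdcomm, hBB]
      simp only [Matrix.mul_smul, Matrix.smul_mul]
    rw [hout, Matrix.conjTranspose_smul, Matrix.smul_mul, Matrix.mul_smul, smul_smul, h4, hss, h3,
      hBU, smul_smul, Matrix.conjTranspose_mul, Matrix.conjTranspose_conjTranspose]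
    simp only [Matrix.mul_smul, Matrix.smul_mul, Matrix.mul_assoc]
  have hW : ((clock d jk.2)ᴴ * U)ᴴ * ((clock d jk.2)ᴴ * U) = 1 := by
    rw [Matrix.conjTranspose_mul, Matrix.conjTranspose_conjTranspose, Matrix.mul_assoc,
      ← Matrix.mul_assoc (clock d jk.2), mul_eq_one_comm.mp (clock_conjTranspose_mul d jk.2),
      Matrix.one_mul, hU]
  funext i
  exact (schmidt_of_gram hrpos (isSchmidt_swapFun hd hx hy) hW hgram i).trans
    (desc_eq_self (swapFun_antitone x y) i)

/-! ### Deterministic protocols on a chain of links -/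

/-- Local measurements at both ends of the link yield, up to scalars, `diag(y)^{1/2}`. -/
def PurifiesTo (d : ℕ) (a : Link) (y : Fin d → ℝ) : Prop :=
  ∃ (k : ℕ) (M : Fin k → Matrix (Fin d) a.Left ℂ), IsMeasurement M ∧
    ∀ α, ∃ (l : ℕ) (N : Fin l → Matrix (Fin d) a.Right ℂ), IsMeasurement N ∧
      ∀ β, ∃ c : ℝ, M α * a.amp * (N β)ᵀ = (c : ℂ) • sqrtDiag y

theorem mem_flatten_ofFn {γ : Type} {k : ℕ} {E : Fin k → List γ} {B : γ} :
    B ∈ (List.ofFn E).flatten ↔ ∃ α, B ∈ E α := by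
  simp [List.mem_flatten, List.mem_ofFn]

/-- Any guarantee on the final outcomes that holds once the link is a multiple of `diag(y)^(1/2)`,
for every scalar, also holds from the original link. The scalar zero accounts for the outcomes that
cannot occur. -/
theorem PurifiesTo.produces {d : ℕ} {a : Link} {y : Fin d → ℝ} (h : PurifiesTo d a y)
    (pre post : List Link) (P : Matrix (Fin d) (Fin d) ℂ → Prop)
    (hP : ∀ c : ℝ, ∃ E, Produces d (pre ++ ⟨Fin d, Fin d, (c : ℂ) • sqrtDiag y⟩ :: post) E ∧
      ∀ B ∈ E, P B) :
    ∃ E, Produces d (pre ++ a :: post) E ∧ ∀ B ∈ E, P B := by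
  obtain ⟨k, M, hM, h⟩ := h
  have h1 : ∀ α, ∃ E, Produces d (pre ++ ⟨Fin d, a.Right, M α * a.amp⟩ :: post) E ∧
      ∀ B ∈ E, P B := by
    intro α
    obtain ⟨l, N, hN, h⟩ := h α
    have h2 : ∀ β, ∃ E, Produces d (pre ++ ⟨Fin d, Fin d, M α * a.amp * (N β)ᵀ⟩ :: post) E ∧
        ∀ B ∈ E, P B := by
      intro β
      obtain ⟨c, hc⟩ := h β
      rw [hc]
      exact hP c
    choose E hE hEP using h2
    refine ⟨_, Produces.measureRight pre post ⟨Fin d, a.Right, M α * a.amp⟩ (Fin d) l N hN E hE,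
      fun B hB => ?_⟩
    obtain ⟨β, hβ⟩ := mem_flatten_ofFn.mp hB
    exact hEP β B hβ
  choose E hE hEP using h1
  refine ⟨_, Produces.measureLeft pre post a (Fin d) k M hM E hE, fun B hB => ?_⟩
  obtain ⟨α, hα⟩ := mem_flatten_ofFn.mp hB
  exact hEP α B hα

/-- The link at A absorbs the chain from the left: purify the next link, swap it in, repeat. This
order matches the left-grouped series rule. A nonzero final probability forces all intermediate ones
to be nonzero. -/
theorem exists_deterministic_chain {d : ℕ} (hd : 0 < d) {L : List Link} {ys : List (Fin d → ℝ)}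
    (h : List.Forall₂ (fun a y => PurifiesTo d a y ∧ IsSchmidt y ∧ Antitone y) L ys) :
    ∀ A : Matrix (Fin d) (Fin d) ℂ, ∃ E, Produces d (⟨Fin d, Fin d, A⟩ :: L) E ∧
      ∀ B ∈ E, prob B ≠ 0 → prob A ≠ 0 ∧ schmidt B = ys.foldl swapFun (schmidt A) := by
  induction h with
  | nil =>
    intro A
    refine ⟨[A], Produces.done A, fun B hB hp => ?_⟩
    rw [List.mem_singleton] at hB
    subst hB
    exact ⟨hp, rfl⟩
  | @cons a y L ys hay _ ih =>
    intro A
    refine hay.1.produces [⟨Fin d, Fin d, A⟩] L _ fun c => ?_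
    obtain ⟨k, X, hX, hXA⟩ := exists_deterministic_swapping hd A hay.2.1 hay.2.2
    choose E hE hEB using fun α => ih (A * X α * ((c : ℂ) • sqrtDiag y))
    refine ⟨_, Produces.swap [] L ⟨Fin d, Fin d, A⟩ ⟨Fin d, Fin d, (c : ℂ) • sqrtDiag y⟩ k X hX
      E hE, fun B hB hp => ?_⟩
    obtain ⟨α, hα⟩ := mem_flatten_ofFn.mp hB
    obtain ⟨h1, h2⟩ := hEB α B hα hp
    obtain ⟨h3, h4⟩ := hXA α c h1
    exact ⟨h3, by rw [h2, h4]; rfl⟩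

theorem schmidt_smul_sqrtDiag {d : ℕ} {y : Fin d → ℝ} (hy : IsSchmidt y) (hya : Antitone y)
    {c : ℝ} (hp : prob ((c : ℂ) • sqrtDiag y) ≠ 0) : schmidt ((c : ℂ) • sqrtDiag y) = y := by
  have hc : c ≠ 0 := by
    rintro rfl
    rw [Complex.ofReal_zero, zero_smul, prob_zero] at hp
    exact hp rfl
  have hgram : ((c : ℂ) • sqrtDiag y)ᴴ * ((c : ℂ) • sqrtDiag y) =
      1 * Matrix.diagonal (fun i => ((c ^ 2 * y i : ℝ) : ℂ)) *
        (1 : Matrix (Fin d) (Fin d) ℂ)ᴴ := by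
    rw [Matrix.conjTranspose_smul, sqrtDiag_conjTranspose, Matrix.smul_mul, Matrix.mul_smul,
      sqrtDiag_mul_sqrtDiag hy.1, smul_smul, ← Matrix.diagonal_smul, Matrix.conjTranspose_one,
      Matrix.one_mul, Matrix.mul_one]
    congr 1
    funext i
    rw [Pi.smul_apply, smul_eq_mul, Complex.star_def, Complex.conj_ofReal]
    push_cast
    ring
  funext i
  exact (schmidt_of_gram (by positivity) hy (by simp) hgram i).trans (desc_eq_self hya i)

/-! ### The parallel rule -/

theorem kron_nonneg {m d : ℕ} {x : Fin m → Fin d → ℝ} (hx : ∀ j, IsSchmidt (x j))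
    (k : Fin m → Fin d) : 0 ≤ kron x k :=
  Finset.prod_nonneg fun j _ => (hx j).1 (k j)

theorem sum_kron {m d : ℕ} {x : Fin m → Fin d → ℝ} (hx : ∀ j, IsSchmidt (x j)) :
    ∑ k, kron x k = 1 := by
  have h := Finset.prod_univ_sum (fun _ : Fin m => (Finset.univ : Finset (Fin d))) x
  rw [Fintype.piFinset_univ] at h
  exact h.symm.trans (Finset.prod_eq_one fun j _ => (hx j).2)

theorem le_card_pi {m d : ℕ} (hm : 0 < m) : d ≤ Fintype.card (Fin m → Fin d) := by
  rw [Fintype.card_fun, Fintype.card_fin, Fintype.card_fin]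
  exact Nat.le_self_pow hm.ne' d

theorem parallelRule_spec {m d : ℕ} (hd : 0 < d) (hm : 0 < m) {x : Fin m → Fin d → ℝ}
    (hx : ∀ j, IsSchmidt (x j)) : IsSchmidt (parallelRule x) ∧ Antitone (parallelRule x) := by
  have h := purifyFun_antitone_nonneg hd (le_card_pi hm) (kron_nonneg hx)
  exact ⟨⟨h.2, (purifyFun_sum hd (le_card_pi hm) (kron_nonneg hx)).trans (sum_kron hx)⟩, h.1⟩

/-- The left measurement leaves a row selection on the right factor; a right measurement adapted to
that selection turns it into the identity or into zero. -/
theorem groupLink_purifiesTo {m d : ℕ} (hd : 0 < d) (hm : 0 < m) {x : Fin m → Fin d → ℝ}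
    (hx : ∀ j, IsSchmidt (x j)) : PurifiesTo d (groupLink x) (parallelRule x) := by
  obtain ⟨k, M, c, s, hM, -, h⟩ :=
    exists_purification_measurement hd (le_card_pi hm) (kron_nonneg hx)
  refine ⟨k, M, hM, fun α => ?_⟩
  obtain ⟨l, N, hN, hs⟩ := exists_selection_measurement hd (s α)
  refine ⟨l, N, hN, fun β => ?_⟩
  have h1 : M α * sqrtDiag (kron x) * (N β)ᵀ =
      (c α : ℂ) • (sqrtDiag (parallelRule x) * (selection (s α) * (N β)ᵀ)) := by
    rw [h α, Matrix.smul_mul, Matrix.mul_assoc]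
    rfl
  rcases hs β with h2 | h2
  · exact ⟨c α, h1.trans (by rw [h2, Matrix.mul_one])⟩
  · exact ⟨0, h1.trans (by rw [h2, Matrix.mul_zero, smul_zero, Complex.ofReal_zero, zero_smul])⟩

theorem potential_sqrtDiag_le {ι : Type} [Fintype ι] [DecidableEq ι] {d : ℕ} (hd : 0 < d)
    (hcard : d ≤ Fintype.card ι) {x : ι → ℝ} (hx : ∀ i, 0 ≤ x i) :
    potential d (sqrtDiag x * (sqrtDiag x)ᴴ) ≤ gConcurrence (purifyFun d x) := by
  have h := potential_diagonal_le hd hcard hx (V := 1) (by simp)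
  rw [gConcurrence_eq hd (purifyFun_antitone_nonneg hd hcard hx).2, sqrtDiag_conjTranspose,
    sqrtDiag_mul_sqrtDiag hx]
  simpa [purifiedG] using h

theorem linkPotential_groupLink_le {m d : ℕ} (hd : 0 < d) (hm : 0 < m) {x : Fin m → Fin d → ℝ}
    (hx : ∀ j, IsSchmidt (x j)) :
    linkPotential d (groupLink x) ≤ gConcurrence (parallelRule x) :=
  potential_sqrtDiag_le hd (le_card_pi hm) (kron_nonneg hx)

theorem linkProb_groupLink {m d : ℕ} {x : Fin m → Fin d → ℝ} (hx : ∀ j, IsSchmidt (x j)) :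
    linkProb (groupLink x) = 1 := by
  change ((sqrtDiag (kron x))ᴴ * sqrtDiag (kron x)).trace.re = 1
  rw [sqrtDiag_conjTranspose, sqrtDiag_mul_sqrtDiag (kron_nonneg hx), Matrix.trace_diagonal,
    ← Complex.ofReal_sum, Complex.ofReal_re, sum_kron hx]

/-! ### Parallel-then-series networks -/

theorem isSchmidt_foldl_swapFun {d : ℕ} (hd : 0 < d) (ys : List (Fin d → ℝ))
    (hys : ∀ y ∈ ys, IsSchmidt y) {x : Fin d → ℝ} (hx : IsSchmidt x) :
    IsSchmidt (ys.foldl swapFun x) ∧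
      gConcurrence (ys.foldl swapFun x) = gConcurrence x * (ys.map gConcurrence).prod := by
  induction ys generalizing x with
  | nil => simpa using hx
  | cons y ys ih =>
    have hy := hys y (by simp)
    obtain ⟨h1, h2⟩ := ih (fun z hz => hys z (by simp [hz])) (isSchmidt_swapFun hd hx hy)
    refine ⟨h1, ?_⟩
    rw [List.foldl_cons, h2, gConcurrence_swapFun hd hx.1 hy.1, List.map_cons, List.prod_cons]
    ring

theorem exists_deterministic_protocol {d : ℕ} (hd : 0 < d) {n : ℕ} {m : Fin (n + 1) → ℕ}
    (hm : ∀ i, 0 < m i) {lam : (i : Fin (n + 1)) → Fin (m i) → Fin d → ℝ}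
    (hlam : ∀ i j, IsSchmidt (lam i j)) :
    ∃ E, Produces d (chain m lam) E ∧
      ∀ A ∈ E, prob A ≠ 0 → schmidt A = parallelThenSeries m lam := by
  have h0 := parallelRule_spec hd (hm 0) (hlam 0)
  have hchain : chain m lam =
      [] ++ groupLink (lam 0) :: List.ofFn fun i : Fin n => groupLink (lam i.succ) := by
    unfold chain
    rw [List.ofFn_succ]
    rfl
  have hall : List.Forall₂ (fun a y => PurifiesTo d a y ∧ IsSchmidt y ∧ Antitone y)
      (List.ofFn fun i : Fin n => groupLink (lam i.succ))
      (List.ofFn fun i : Fin n => parallelRule (lam i.succ)) := by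
    rw [List.forall₂_iff_get]
    refine ⟨by simp, fun i h1 h2 => ?_⟩
    simp only [List.get_eq_getElem, List.getElem_ofFn]
    exact ⟨groupLink_purifiesTo hd (hm _) (hlam _), parallelRule_spec hd (hm _) (hlam _)⟩
  rw [hchain]
  refine (groupLink_purifiesTo hd (hm 0) (hlam 0)).produces [] _ _ fun c => ?_
  obtain ⟨E, hE, h⟩ := exists_deterministic_chain hd hall
    ((c : ℂ) • sqrtDiag (parallelRule (lam 0)))
  refine ⟨E, hE, fun B hB hp => ?_⟩
  obtain ⟨h1, h2⟩ := h B hB hp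
  rw [h2, schmidt_smul_sqrtDiag h0.1 h0.2 h1]
  rfl

/-- The product of potentials is bounded factor by factor by the G-concurrences of the purified
groups, whose product is that of the series rule by multiplicativity. -/
theorem averageG_le_parallelThenSeries {d : ℕ} (hd : 0 < d) {n : ℕ} {m : Fin (n + 1) → ℕ}
    (hm : ∀ i, 0 < m i) {lam : (i : Fin (n + 1)) → Fin (m i) → Fin d → ℝ}
    (hlam : ∀ i j, IsSchmidt (lam i j)) {E : List (Matrix (Fin d) (Fin d) ℂ)}
    (hE : Produces d (chain m lam) E) :
    averageG E ≤ gConcurrence (parallelThenSeries m lam) := by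
  refine (hE.averageG_le hd).trans ?_
  have h1 := (isSchmidt_foldl_swapFun hd (List.ofFn fun i : Fin n => parallelRule (lam i.succ))
    (fun y hy => by
      obtain ⟨i, rfl⟩ := (List.mem_ofFn' _ _).mp hy
      exact (parallelRule_spec hd (hm _) (hlam _)).1)
    (parallelRule_spec hd (hm 0) (hlam 0)).1).2
  unfold parallelThenSeries seriesRule chain
  rw [h1, List.map_ofFn, List.map_ofFn, List.prod_ofFn, List.prod_ofFn]
  simp only [Function.comp_apply]
  rw [← Fin.prod_univ_succ (fun i => gConcurrence (parallelRule (lam i)))]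
  exact Finset.prod_le_prod (fun i _ => linkPotential_nonneg _ _)
    fun i _ => linkPotential_groupLink_le hd (hm i) (hlam i)

theorem averageG_eq_of_deterministic {d : ℕ} {E : List (Matrix (Fin d) (Fin d) ℂ)}
    {y : Fin d → ℝ} (h : ∀ A ∈ E, prob A ≠ 0 → schmidt A = y) :
    averageG E = (E.map prob).sum * gConcurrence y := by
  unfold averageG
  rw [← List.sum_map_mul_right]
  congr 1
  refine List.map_congr_left fun A hA => ?_
  by_cases hp : prob A = 0
  · rw [hp, zero_mul, zero_mul]
  · rw [h A hA hp]

theorem isGreatest_averageG {d : ℕ} (hd : 0 < d) {n : ℕ} {m : Fin (n + 1) → ℕ}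
    (hm : ∀ i, 0 < m i) {lam : (i : Fin (n + 1)) → Fin (m i) → Fin d → ℝ}
    (hlam : ∀ i j, IsSchmidt (lam i j)) :
    IsGreatest {c : ℝ | ∃ E, Produces d (chain m lam) E ∧ averageG E = c}
      (gConcurrence (parallelThenSeries m lam)) := by
  refine ⟨?_, ?_⟩
  · obtain ⟨E, hE, h⟩ := exists_deterministic_protocol hd hm hlam
    refine ⟨E, hE, ?_⟩
    rw [averageG_eq_of_deterministic h, hE.sum_prob]
    unfold chain
    rw [List.map_ofFn, List.prod_ofFn]
    simp only [Function.comp_apply]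
    rw [Finset.prod_eq_one fun i _ => linkProb_groupLink (hlam i), one_mul]
  · rintro c ⟨E, hE, rfl⟩
    exact averageG_le_parallelThenSeries hd hm hlam hE

/-! ### Nested purification -/

theorem sqrtDiag_kronecker {ι κ : Type} [DecidableEq ι] [DecidableEq κ] {a : ι → ℝ}
    {b : κ → ℝ} (ha : ∀ i, 0 ≤ a i) :
    sqrtDiag a ⊗ₖ sqrtDiag b = sqrtDiag fun p : ι × κ => a p.1 * b p.2 := by
  unfold sqrtDiag
  rw [Matrix.diagonal_kronecker_diagonal]
  congr 1
  funext p
  rw [Real.sqrt_mul (ha p.1), Complex.ofReal_mul]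

theorem purifyFun_prod {d : ℕ} (a b : Fin d → ℝ) :
    purifyFun d (fun p : Fin d × Fin d => a p.1 * b p.2) = parallelRule ![a, b] := by
  unfold parallelRule
  rw [← purifyFun_comp_equiv d _ (finTwoArrowEquiv (Fin d))]
  congr 1
  funext k
  simp [kron, Fin.prod_univ_two]

theorem le_card_prod {d : ℕ} (hd : 0 < d) : d ≤ Fintype.card (Fin d × Fin d) := by
  rw [Fintype.card_prod, Fintype.card_fin]
  exact Nat.le_mul_of_pos_left d hd

theorem potential_kronecker_le {d : ℕ} (hd : 0 < d) {a b : Fin d → ℝ} (ha : IsSchmidt a)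
    (hb : IsSchmidt b) :
    potential d ((sqrtDiag a ⊗ₖ sqrtDiag b) * (sqrtDiag a ⊗ₖ sqrtDiag b)ᴴ) ≤
      gConcurrence (parallelRule ![a, b]) := by
  rw [sqrtDiag_kronecker ha.1, ← purifyFun_prod]
  exact potential_sqrtDiag_le hd (le_card_prod hd) fun p => mul_nonneg (ha.1 _) (hb.1 _)

theorem isSchmidt_parallelRule_pair {d : ℕ} (hd : 0 < d) {a b : Fin d → ℝ} (ha : IsSchmidt a)
    (hb : IsSchmidt b) : IsSchmidt (parallelRule ![a, b]) :=
  (parallelRule_spec hd two_pos fun j => by fin_cases j; exacts [ha, hb]).1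

theorem NestedProduces.averageG_le_sum {d : ℕ} (hd : 0 < d) {a b c e : Fin d → ℝ}
    {E : List (Matrix (Fin d) (Fin d) ℂ)} (h : NestedProduces a b c e E) :
    ∃ (k l : ℕ) (X : Fin k → Matrix (Fin d) (Fin d) ℂ) (Y : Fin l → Matrix (Fin d) (Fin d) ℂ),
      IsSwapping X ∧ IsSwapping Y ∧ averageG E ≤ ∑ α, ∑ β, potential d
        (((sqrtDiag a * X α * sqrtDiag c) ⊗ₖ (sqrtDiag b * Y β * sqrtDiag e)) *
        ((sqrtDiag a * X α * sqrtDiag c) ⊗ₖ (sqrtDiag b * Y β * sqrtDiag e))ᴴ) := by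
  obtain ⟨k, l, X, Y, F, hX, hY, hF, rfl⟩ := h
  refine ⟨k, l, X, Y, hX, hY, ?_⟩
  rw [averageG_flatten]
  refine Finset.sum_le_sum fun α _ => ?_
  rw [averageG_flatten]
  refine Finset.sum_le_sum fun β _ => ((hF α β).averageG_le hd).trans (le_of_eq ?_)
  simp [linkPotential]

/-- Two independent swappings are one swapping of `a ⊗ b` with `c ⊗ e` by the family `X ⊗ Y`, so the
general swapping bound applies. -/
theorem NestedProduces.averageG_le {d : ℕ} (hd : 0 < d) {a b c e : Fin d → ℝ}
    (ha : IsSchmidt a) (hb : IsSchmidt b) (hc : IsSchmidt c) (he : IsSchmidt e)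
    {E : List (Matrix (Fin d) (Fin d) ℂ)} (h : NestedProduces a b c e E) :
    averageG E ≤ gConcurrence (swapFun (parallelRule ![a, b]) (parallelRule ![c, e])) := by
  obtain ⟨k, l, X, Y, hX, hY, hle⟩ := h.averageG_le_sum hd
  have hab := isSchmidt_parallelRule_pair hd ha hb
  have hce := isSchmidt_parallelRule_pair hd hc he
  rw [gConcurrence_swapFun hd hab.1 hce.1]
  refine hle.trans ?_
  rw [← Fintype.sum_prod_type' (f := fun α β => potential d
        (((sqrtDiag a * X α * sqrtDiag c) ⊗ₖ (sqrtDiag b * Y β * sqrtDiag e)) *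
        ((sqrtDiag a * X α * sqrtDiag c) ⊗ₖ (sqrtDiag b * Y β * sqrtDiag e))ᴴ))]
  have hXY : ∀ μ ν μ' ν', ∑ p : Fin k × Fin l,
      star ((X p.1 ⊗ₖ Y p.2) μ ν) * (X p.1 ⊗ₖ Y p.2) μ' ν' =
      (if μ = μ' then 1 else 0) * (if ν = ν' then 1 else 0) := by
    rintro ⟨μ₁, μ₂⟩ ⟨ν₁, ν₂⟩ ⟨μ₁', μ₂'⟩ ⟨ν₁', ν₂'⟩
    have h1 : ∀ p : Fin k × Fin l, star ((X p.1 ⊗ₖ Y p.2) (μ₁, μ₂) (ν₁, ν₂)) *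
        (X p.1 ⊗ₖ Y p.2) (μ₁', μ₂') (ν₁', ν₂') =
        (star (X p.1 μ₁ ν₁) * X p.1 μ₁' ν₁') * (star (Y p.2 μ₂ ν₂) * Y p.2 μ₂' ν₂') := by
      intro p
      simp only [Matrix.kroneckerMap_apply, StarMul.star_mul]
      ring
    rw [Finset.sum_congr rfl fun p _ => h1 p, Fintype.sum_prod_type]
    simp_rw [← Finset.mul_sum, ← Finset.sum_mul]
    rw [hX, hY]
    simp only [Prod.mk.injEq, ite_and, mul_ite, mul_one, mul_zero]
    split_ifs <;> rfl
  have h2 := sum_potential_swap hd (sqrtDiag a ⊗ₖ sqrtDiag b) (sqrtDiag c ⊗ₖ sqrtDiag e) hXY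
  simp only [← Matrix.mul_kronecker_mul] at h2
  have hnn : 0 ≤ potential d ((sqrtDiag c ⊗ₖ sqrtDiag e) * (sqrtDiag c ⊗ₖ sqrtDiag e)ᴴ) :=
    potential_nonneg (posSemidef_factor' _)
  refine h2.trans (mul_le_mul (potential_kronecker_le hd ha hb) (potential_kronecker_le hd hc he)
    hnn ?_)
  rw [gConcurrence_eq hd hab.1]
  exact mul_nonneg (Nat.cast_nonneg d)
    (Real.rpow_nonneg (Finset.prod_nonneg fun i _ => hab.1 i) _)

/-! ### Nested purification is not optimal -/

theorem isSchmidt_uniform {d : ℕ} (hd : 0 < d) : IsSchmidt fun _ : Fin d => 1 / (d : ℝ) := by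
  have hd' : (d : ℝ) ≠ 0 := by exact_mod_cast hd.ne'
  exact ⟨fun _ => by positivity, by simp [hd']⟩

theorem gConcurrence_uniform {d : ℕ} (hd : 0 < d) :
    gConcurrence (fun _ : Fin d => 1 / (d : ℝ)) = 1 := by
  have hd' : (0 : ℝ) < d := by exact_mod_cast hd
  rw [gConcurrence_eq hd fun _ => by positivity, Finset.prod_const, Finset.card_univ,
    Fintype.card_fin, ← Real.rpow_natCast, ← Real.rpow_mul (by positivity),
    mul_one_div_cancel hd'.ne', Real.rpow_one]
  field_simp

theorem desc_le {ι : Type} [Fintype ι] {x : ι → ℝ} {t : ℝ} (ht : 0 ≤ t) (hx : ∀ i, x i ≤ t)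
    (l : ℕ) : desc x l ≤ t := by
  obtain ⟨e, -, h⟩ := exists_sorting_equiv x
  rw [h]
  split_ifs
  exacts [hx _, ht]

/-- If no entry exceeds `1 / d`, the mean of the remaining weight wins from the start and never
changes. -/
theorem purifyFun_eq_uniform {ι : Type} [Fintype ι] {d : ℕ} (hd : 0 < d) {x : ι → ℝ}
    (hsum : ∑ i, x i = 1) (hx : ∀ i, x i ≤ 1 / (d : ℝ)) :
    purifyFun d x = fun _ => 1 / (d : ℝ) := by
  have hd' : (0 : ℝ) < d := by exact_mod_cast hd
  have hpos : ∀ l : ℕ, l < d → (0 : ℝ) < (d : ℝ) - l := fun l hl => by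
    have : (l : ℝ) < d := by exact_mod_cast hl
    linarith
  have hdesc := desc_le (by positivity) hx
  have hrem : ∀ l : ℕ, l ≤ d → remainder d x l = ((d : ℝ) - l) * (1 / d) := by
    intro l
    induction l with
    | zero =>
      intro _
      simp only [remainder, hsum]
      field_simp
      simp
    | succ l ih =>
      intro hl
      rw [remainder, ih (by omega), mul_div_cancel_left₀ _ (hpos l hl).ne', max_eq_right (hdesc l)]
      push_cast
      ring
  funext l
  rw [purifyFun, hrem l l.2.le, mul_div_cancel_left₀ _ (hpos l l.2).ne', max_eq_right (hdesc l)]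

theorem IsSchmidt.le_one {d : ℕ} {x : Fin d → ℝ} (hx : IsSchmidt x) (i : Fin d) : x i ≤ 1 := by
  rw [← hx.2]
  exact Finset.single_le_sum (fun j _ => hx.1 j) (Finset.mem_univ i)

theorem sum_prod_mul {d : ℕ} (f g : Fin d → ℝ) :
    ∑ p : Fin d × Fin d, f p.1 * g p.2 = (∑ i, f i) * ∑ i, g i := by
  rw [Fintype.sum_prod_type, Finset.sum_mul_sum]

theorem parallelRule_uniform {d : ℕ} (hd : 0 < d) {b : Fin d → ℝ} (hb : IsSchmidt b) :
    parallelRule ![fun _ => 1 / (d : ℝ), b] = (fun _ => 1 / (d : ℝ)) ∧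
      parallelRule ![b, fun _ => 1 / (d : ℝ)] = fun _ => 1 / (d : ℝ) := by
  have hd' : (0 : ℝ) < d := by exact_mod_cast hd
  have hu := (isSchmidt_uniform hd).2
  rw [← purifyFun_prod, ← purifyFun_prod]
  constructor <;> refine purifyFun_eq_uniform hd ?_ fun p => ?_
  · exact (sum_prod_mul (fun _ => 1 / (d : ℝ)) b).trans (by rw [hu, hb.2, one_mul])
  · exact mul_le_of_le_one_right (by positivity) (hb.le_one _)
  · exact (sum_prod_mul b fun _ => 1 / (d : ℝ)).trans (by rw [hu, hb.2, one_mul])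
  · exact mul_le_of_le_one_left (by positivity) (hb.le_one _)

/-- With maximally entangled `a` and `e`, swapping acts as local measurements on `c` and `b`. -/
theorem NestedProduces.averageG_le_of_uniform {d : ℕ} (hd : 0 < d) {b c : Fin d → ℝ}
    {E : List (Matrix (Fin d) (Fin d) ℂ)}
    (h : NestedProduces (fun _ => 1 / (d : ℝ)) b c (fun _ => 1 / (d : ℝ)) E) :
    averageG E ≤
      potential d ((sqrtDiag c ⊗ₖ sqrtDiag b) * (sqrtDiag c ⊗ₖ sqrtDiag b)ᴴ) := by
  have hd' : (0 : ℝ) < d := by exact_mod_cast hd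
  obtain ⟨k, l, X, Y, hX, hY, hle⟩ := h.averageG_le_sum hd
  refine hle.trans ?_
  set s : ℂ := ((Real.sqrt (1 / d) : ℝ) : ℂ) with hs
  have hss : s * s * d = 1 := by
    rw [hs, ← Complex.ofReal_mul, Real.mul_self_sqrt (by positivity), ← Complex.ofReal_natCast,
      ← Complex.ofReal_mul, one_div, inv_mul_cancel₀ hd'.ne', Complex.ofReal_one]
  have hstar : star s = s := by rw [hs, Complex.star_def, Complex.conj_ofReal]
  have hu : (sqrtDiag fun _ : Fin d => 1 / (d : ℝ)) = s • (1 : Matrix (Fin d) (Fin d) ℂ) := by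
    rw [Matrix.smul_one_eq_diagonal]
    rfl
  -- A swapping family scaled by `d^(-1/2)` is complete as a measurement from either side. Swapping
  -- through a maximally entangled `a` thus measures `c` at its left end, and through `e` it
  -- measures `b` at its right end.
  let M : Fin k → Matrix (Fin d × Fin d) (Fin d × Fin d) ℂ := fun α => (s • X α) ⊗ₖ 1
  let N : Fin l → Matrix (Fin d × Fin d) (Fin d × Fin d) ℂ := fun β => 1 ⊗ₖ (s • Y β)
  have hsplit : ∀ α β, (sqrtDiag (fun _ : Fin d => 1 / (d : ℝ)) * X α * sqrtDiag c) ⊗ₖ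
      (sqrtDiag b * Y β * sqrtDiag (fun _ : Fin d => 1 / (d : ℝ))) =
      M α * (sqrtDiag c ⊗ₖ sqrtDiag b) * N β := by
    intro α β
    simp only [M, N, ← Matrix.mul_kronecker_mul, hu, Matrix.smul_mul, Matrix.mul_smul,
      Matrix.one_mul, Matrix.mul_one]
  have hM : ∑ α, (M α)ᴴ * M α = 1 := by
    have h1 : ∀ α, (M α)ᴴ * M α = (s * s) • (((X α)ᴴ * X α) ⊗ₖ (1 : Matrix (Fin d) (Fin d) ℂ)) := by
      intro α
      simp only [M, Matrix.conjTranspose_kronecker, ← Matrix.mul_kronecker_mul,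
        Matrix.conjTranspose_smul, Matrix.conjTranspose_one, Matrix.mul_one, hstar,
        Matrix.smul_mul, Matrix.mul_smul, smul_smul, Matrix.smul_kronecker]
    have h2 : ∑ α, (X α)ᴴ * X α = (d : ℂ) • (1 : Matrix (Fin d) (Fin d) ℂ) := by
      ext ν ν'
      rw [Matrix.sum_apply]
      simp only [Matrix.mul_apply, Matrix.conjTranspose_apply]
      rw [Finset.sum_comm, Finset.sum_congr rfl fun μ _ => hX μ ν μ ν']
      simp [Matrix.one_apply]
    have h3 : ∑ α, ((X α)ᴴ * X α) ⊗ₖ (1 : Matrix (Fin d) (Fin d) ℂ) =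
        (∑ α, (X α)ᴴ * X α) ⊗ₖ (1 : Matrix (Fin d) (Fin d) ℂ) := by
      ext p q
      simp only [Matrix.sum_apply, Matrix.kroneckerMap_apply, Finset.sum_mul]
    rw [Finset.sum_congr rfl fun α _ => h1 α, ← Finset.smul_sum, h3, h2, Matrix.smul_kronecker,
      smul_smul, hss, one_smul, Matrix.one_kronecker_one]
  have hN : ∑ β, N β * (N β)ᴴ = 1 := by
    have h1 : ∀ β, N β * (N β)ᴴ = (s * s) • ((1 : Matrix (Fin d) (Fin d) ℂ) ⊗ₖ (Y β * (Y β)ᴴ)) := by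
      intro β
      simp only [N, Matrix.conjTranspose_kronecker, ← Matrix.mul_kronecker_mul,
        Matrix.conjTranspose_smul, Matrix.conjTranspose_one, Matrix.mul_one, hstar,
        Matrix.smul_mul, Matrix.mul_smul, smul_smul, Matrix.kronecker_smul]
    have h2 : ∑ β, Y β * (Y β)ᴴ = (d : ℂ) • (1 : Matrix (Fin d) (Fin d) ℂ) := by
      have := sum_swapping_conj hY 1
      simpa using this
    have h3 : ∑ β, (1 : Matrix (Fin d) (Fin d) ℂ) ⊗ₖ (Y β * (Y β)ᴴ) =
        (1 : Matrix (Fin d) (Fin d) ℂ) ⊗ₖ (∑ β, Y β * (Y β)ᴴ) := by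
      ext p q
      simp only [Matrix.sum_apply, Matrix.kroneckerMap_apply, Finset.mul_sum]
    rw [Finset.sum_congr rfl fun β _ => h1 β, ← Finset.smul_sum, h3, h2, Matrix.kronecker_smul,
      smul_smul, hss, one_smul, Matrix.one_kronecker_one]
  simp_rw [hsplit]
  exact (Finset.sum_le_sum fun α _ =>
    sum_potential_measureRight (M α * (sqrtDiag c ⊗ₖ sqrtDiag b)) hN).trans
    (sum_potential_measureLeft hd _ hM)

/-- With `a` and `e` uniform, both parallel groups purify to the uniform vector and the
deterministic value is one. A nested protocol must instead purify `c ⊗ b`, whose dominant entry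
cannot be evened out. -/
theorem exists_nested_gap {d : ℕ} (hd : 2 ≤ d) :
    ∃ a b c e : Fin d → ℝ, (IsSchmidt a ∧ IsSchmidt b ∧ IsSchmidt c ∧ IsSchmidt e) ∧
      (∀ i, 0 < a i ∧ 0 < b i ∧ 0 < c i ∧ 0 < e i) ∧
      ∃ g < gConcurrence (swapFun (parallelRule ![a, b]) (parallelRule ![c, e])),
        ∀ E, NestedProduces a b c e E → averageG E ≤ g := by
  have hd0 : 0 < d := by omega
  have hd1 : (0 : ℝ) < (d : ℝ) - 1 := by
    have : (2 : ℝ) ≤ d := by exact_mod_cast hd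
    linarith
  have hdpos : (0 : ℝ) < d := by linarith
  let o : Fin d := ⟨0, hd0⟩
  let b : Fin d → ℝ := fun i => if i = o then 15 / 16 else 1 / (16 * ((d : ℝ) - 1))
  have hbpos : ∀ i, 0 < b i := fun i => by
    simp only [b]
    split_ifs <;> positivity
  have hb : IsSchmidt b := by
    refine ⟨fun i => (hbpos i).le, ?_⟩
    rw [← Finset.add_sum_erase _ _ (Finset.mem_univ o)]
    have h1 : ∀ i ∈ Finset.univ.erase o, b i = 1 / (16 * ((d : ℝ) - 1)) := fun i hi => by
      simp only [b, if_neg (Finset.ne_of_mem_erase hi)]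
    rw [Finset.sum_congr rfl h1, Finset.sum_const, Finset.card_erase_of_mem (Finset.mem_univ o),
      Finset.card_univ, Fintype.card_fin, nsmul_eq_mul, Nat.cast_sub (by omega), Nat.cast_one]
    simp only [b, if_true]
    field_simp
    norm_num
  have hu := isSchmidt_uniform hd0
  have hupos : (0 : ℝ) < 1 / (d : ℝ) := by positivity
  -- The bound is the trace of the weight below: `2 - (3/2) * (15/16)^2 = 349/512`. The entry
  -- `15/16` is chosen so that this stays below one.
  refine ⟨fun _ => 1 / (d : ℝ), b, b, fun _ => 1 / (d : ℝ), ⟨hu, hb, hb, hu⟩,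
    fun i => ⟨hupos, hbpos i, hbpos i, hupos⟩, 349 / 512, ?_, fun E hE => ?_⟩
  · rw [(parallelRule_uniform hd0 hb).1, (parallelRule_uniform hd0 hb).2,
      gConcurrence_swapFun hd0 hu.1 hu.1, gConcurrence_uniform hd0]
    norm_num
  · refine (hE.averageG_le_of_uniform hd0).trans ?_
    have hxnn : ∀ p : Fin d × Fin d, 0 ≤ b p.1 * b p.2 := fun p =>
      mul_nonneg (hbpos _).le (hbpos _).le
    -- Halving the dominant entry is compensated by doubling any other one, and `d ≥ 2` distinct
    -- indices always include another, so all products of weights are at least one.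
    let w : Fin d × Fin d → ℝ := fun p => if p = (o, o) then 1 / 2 else 2
    have hw : Admissible d (Matrix.diagonal fun p => (w p : ℂ)) := by
      refine admissible_diagonal (fun p => ?_) fun f => ?_
      · simp only [w]
        split_ifs <;> norm_num
      · by_cases hf : ∃ k0, f k0 = (o, o)
        · obtain ⟨k0, hk0⟩ := hf
          rw [← Finset.mul_prod_erase _ _ (Finset.mem_univ k0)]
          have h1 : ∀ k ∈ Finset.univ.erase k0, w (f k) = 2 := fun k hk => by
            have : f k ≠ (o, o) := fun h =>
              Finset.ne_of_mem_erase hk (f.injective (h.trans hk0.symm))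
            simp only [w, if_neg this]
          rw [Finset.prod_congr rfl h1, Finset.prod_const,
            Finset.card_erase_of_mem (Finset.mem_univ k0), Finset.card_univ, Fintype.card_fin]
          simp only [w, hk0, if_true]
          have h2 : (2 : ℝ) ^ 1 ≤ 2 ^ (d - 1) := pow_le_pow_right₀ (by norm_num) (by omega)
          linarith
        · have h1 : ∀ k ∈ Finset.univ, w (f k) = 2 := fun k _ => by
            simp only [w, if_neg fun h => hf ⟨k, h⟩]
          rw [Finset.prod_congr rfl h1, Finset.prod_const]
          exact one_le_pow₀ (by norm_num)
    have hsum : ∑ p : Fin d × Fin d, b p.1 * b p.2 = 1 := by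
      rw [sum_prod_mul, hb.2, one_mul]
    refine (potential_le hw (posSemidef_factor' _)).trans (le_of_eq ?_)
    rw [sqrtDiag_kronecker hb.1, sqrtDiag_conjTranspose, sqrtDiag_mul_sqrtDiag hxnn,
      trace_diagonal_mul_diagonal]
    have h3 : ∀ p : Fin d × Fin d, w p * (b p.1 * b p.2) =
        2 * (b p.1 * b p.2) - (if p = (o, o) then 3 / 2 * (b p.1 * b p.2) else 0) := by
      intro p
      simp only [w]
      split_ifs <;> ring
    rw [Finset.sum_congr rfl fun p _ => h3 p, Finset.sum_sub_distrib, ← Finset.mul_sum, hsum]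
    simp only [Finset.sum_ite_eq', Finset.mem_univ, if_true, b]
    norm_num

end

end DET

end

theorem mainTheorem1 (d : ℕ) (hd : 0 < d) :
    (∀ (n : ℕ) (m : Fin (n + 1) → ℕ) (_ : ∀ i, 0 < m i)
        (lam : (i : Fin (n + 1)) → Fin (m i) → Fin d → ℝ)
        (_ : ∀ i j, DET.IsSchmidt (lam i j)),
      (∃ E, DET.Produces d (DET.chain m lam) E ∧
        ∀ A ∈ E, DET.prob A ≠ 0 → DET.schmidt A = DET.parallelThenSeries m lam) ∧
      IsGreatest {c : ℝ | ∃ E, DET.Produces d (DET.chain m lam) E ∧ DET.averageG E = c}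
        (DET.gConcurrence (DET.parallelThenSeries m lam))) ∧
    (∀ a b c e : Fin d → ℝ, DET.IsSchmidt a → DET.IsSchmidt b →
        DET.IsSchmidt c → DET.IsSchmidt e →
      ∀ E, DET.NestedProduces a b c e E →
        DET.averageG E ≤ DET.gConcurrence
          (DET.swapFun (DET.parallelRule ![a, b]) (DET.parallelRule ![c, e]))) ∧
    (2 ≤ d → ∃ a b c e : Fin d → ℝ,
      (DET.IsSchmidt a ∧ DET.IsSchmidt b ∧ DET.IsSchmidt c ∧ DET.IsSchmidt e) ∧
      (∀ i, 0 < a i ∧ 0 < b i ∧ 0 < c i ∧ 0 < e i) ∧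
      ∃ g < DET.gConcurrence
          (DET.swapFun (DET.parallelRule ![a, b]) (DET.parallelRule ![c, e])),
        ∀ E, DET.NestedProduces a b c e E → DET.averageG E ≤ g) := by
  refine ⟨fun n m hm lam hlam => ⟨DET.exists_deterministic_protocol hd hm hlam,
      DET.isGreatest_averageG hd hm hlam⟩,
    fun a b c e ha hb hc he E hE => hE.averageG_le hd ha hb hc he,
    fun h2 => DET.exists_nested_gap h2⟩
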